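/- Setting. A map $f:\mathbb C\to\mathbb{C}P^2$ is a conformally parametrized minimal Lagrangian immersion with metric $2e^{u}\,dz\,d\bar z$ and Hopf differential $\Psi\,dz^3$ if it has a smooth lift $F:\mathbb C\to S^5\subset\mathbb C^3$ which is horizontal, $F_z\cdot\bar F=F_{\bar z}\cdot\bar F=0$, conformal, $F_z\cdot\overline{F_z}=F_{\bar z}\cdot\overline{F_{\bar z}}=e^u$, $F_z\cdot\overline{F_{\bar z}}=0$, with $F_{z\bar z}\in\mathbb C F$ (minimality) and $\Psi=F_{zz}\cdot\overline{F_{\bar z}}$. For $\lambda\in S^1$, the member $f(\cdot,\lambda)$ of the associated family with data $(u,\psi)$ is the minimal Lagrangian immersion with metric $2e^u\,dz\,d\bar z$ and Hopf differential $-i\lambda^{-3}\psi\,dz^3$ (unique up to isometry). The immersion $f$ is translationally equivariant if $f(t+z)=R(t)f(z)$ for all $t\in\mathbb R$, $z\in\mathbb C$ and some one-parameter subgroup $R$ of $SU(3)$; then $u$ depends only on $y=\operatorname{Im}z$ and $\psi$ is constant. We call $f$ an equivariant cylinder relative to the translation by $\omega$ if $\omega\ne0$ and $f(z+\omega)=f(z)$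 for all $z$. Fix $\lambda_0\in S^1$ and let $f(\cdot,\lambda_0):\mathbb C\to\mathbb{C}P^2$ be a member of an associated family with data $(u,\psi)$ which is translationally equivariant, with $\psi\not\equiv0$. Write $a_1=e^{u(0)}$, $\beta=2a_1+|\psi|^2/a_1^2$, $h=\frac{\beta}{2}-a_1$, $a_2=\frac12\bigl(h+\sqrt{h^2+4a_1h}\bigr)$, $a_3=\frac12\bigl(-h+\sqrt{h^2+4a_1h}\bigr)$, and assume the normalization $u'(0)=0$ and $a_2<a_1$ (the surface is not flat, and the origin is a maximum of the metric factor). Let $k^2=\frac{a_1-a_2}{a_1+a_3}$, $r=\sqrt{2(a_1+a_3)}$, $K=\int_0^{\pi/2}\frac{d\alpha}{\sqrt{1-k^2\sin^2\alpha}}$ and $T=K/r$, so that $2T$ is the period of $u(y)$. Let $id_1,id_2,id_3$ $(d_j\in\mathbb R)$ be the eigenvalues, with multiplicity and in any order, of $$D(\lambda_0)=\begin{pmatrix}0&-i\lambda_0\bar\psi a_1^{-1}&i\lambda_0^{-1}a_1^{1/2}\\-i\lambda_0^{-1}\psi a_1^{-1}&0&i\lambda_0a_1^{1/2}\\i\lambda_0a_1^{1/2}&i\lambda_0^{-1}a_1^{1/2}&0\end{pmatrix},$$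 and put $$\beta_1(y)=\int_0^y\frac{2i\lambda_0^3\bar\psi-iu'e^u}{\lambda_0^3\bar\psi-\lambda_0^{-3}\psi-e^uu'}\,ds,\qquad \beta_2(y)=\int_0^y\frac{2e^u}{\lambda_0^3\bar\psi-\lambda_0^{-3}\psi-e^uu'}\,ds .$$ Claim. (1) Real translations: if $d_2\neq0$, then $f(\cdot,\lambda_0)$ is an equivariant cylinder relative to some real translation $\omega=p$, $p\in\mathbb R\setminus\{0\}$, if and only if $d_1/d_2$ is rational. (2) Purely imaginary translations: $f(\cdot,\lambda_0)$ is an equivariant cylinder relative to some translation $\omega=m\cdot2Ti$, $m\in\mathbb Z\setminus\{0\}$, if and only if there are rational numbers $r_1,r_2$ with $$\operatorname{Re}\beta_1(2T)\,d_j+\operatorname{Im}\beta_2(2T)\Bigl(-d_j^2+\frac{2\beta}{3}\Bigr)=2\pi r_j\qquad(j=1,2).$$ Here, if $\lambda_0^{-3}\psi$ is not real, the integrals $\beta_1(2T)$ and $\beta_2(2T)$ converge absolutely. If $\lambda_0^{-3}\psi$ is real, their common denominator $N(s)$ has zeros and they are read as Cauchy principal values, i.e. as the limits for $\varepsilon\to0^+$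 of the integrals over $\{s\in(0,2T]:|N(s)|>\varepsilon\}$; these limits exist. -/

import Mathlib

open Complex MeasureTheory Filter Topology Polynomial
open scoped LinearAlgebra.Projectivization Matrix ContDiff

namespace MinLag

/-- The complex projective plane, as the space of complex lines in `ℂ³`. -/
abbrev CP2 : Type := ℙ ℂ (Fin 3 → ℂ)

/-- The Hermitian product `Z · W̄ = ∑ₖ zₖ w̄ₖ` on `ℂ³`. -/
def herm (Z W : Fin 3 → ℂ) : ℂ := ∑ k, Z k * (starRingEnd ℂ) (W k)

/-- The Wirtinger derivative `F_z = (F_x - i F_y) / 2`. -/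
noncomputable def dz (F : ℂ → Fin 3 → ℂ) (z : ℂ) : Fin 3 → ℂ :=
  (1 / 2 : ℂ) • (fderiv ℝ F z 1 - I • fderiv ℝ F z I)

/-- The Wirtinger derivative `F_z̄ = (F_x + i F_y) / 2`. -/
noncomputable def dzbar (F : ℂ → Fin 3 → ℂ) (z : ℂ) : Fin 3 → ℂ :=
  (1 / 2 : ℂ) • (fderiv ℝ F z 1 + I • fderiv ℝ F z I)

/-- `F : ℂ → S⁵ ⊆ ℂ³` is a smooth horizontal lift of `f : ℂ → ℂP²` for the Hopf fibration. -/
structure IsHorizontalLift (F : ℂ → Fin 3 → ℂ) (f : ℂ → CP2) : Prop where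
  smooth : ContDiff ℝ ∞ F
  norm_one : ∀ z, herm (F z) (F z) = 1
  lifts : ∀ z, ∃ h : F z ≠ 0, f z = Projectivization.mk ℂ (F z) h
  horizontal : ∀ z, herm (dz F z) (F z) = 0
  horizontal' : ∀ z, herm (dzbar F z) (F z) = 0

/-- `f : ℂ → ℂP²` is a conformally parametrized minimal Lagrangian immersion with induced metric
`2 e^u dz dz̄` and Hopf differential `Ψ dz³`.

A map from the simply connected domain `ℂ` is Lagrangian exactly when it has a horizontal lift `F`
to `S⁵`. The Hopf fibration is a Riemannian submersion, so the metric of `f` is read off from `F`,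
and the mean curvature vector of the conformal immersion `f` is, up to a positive factor, the
projection of the component of `F_{z z̄}` orthogonal to `ℂ F`; hence minimality says that
`F_{z z̄}` is a multiple of `F`. -/
def IsMinimalLagrangian (f : ℂ → CP2) (u : ℂ → ℝ) (Ψ : ℂ → ℂ) : Prop :=
  ∃ F : ℂ → Fin 3 → ℂ, IsHorizontalLift F f ∧
    (∀ z, herm (dz F z) (dz F z) = (Real.exp (u z) : ℂ)) ∧
    (∀ z, herm (dzbar F z) (dzbar F z) = (Real.exp (u z) : ℂ)) ∧
    (∀ z, herm (dz F z) (dzbar F z) = 0) ∧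
    (∀ z, ∃ c : ℂ, dzbar (dz F) z = c • F z) ∧
    (∀ z, Ψ z = herm (dz (dz F) z) (dzbar F z))

/-- `f` is the member at the spectral parameter `lam ∈ S¹` of the associated family with metric
`2 e^u dz dz̄` and cubic differential `ψ dz³`: the minimal Lagrangian immersion with the same metric
and with Hopf differential `ν ψ dz³`, where `i lam³ ν = 1`. -/
def IsAssociatedMember (lam : Circle) (u : ℂ → ℝ) (ψ : ℂ → ℂ) (f : ℂ → CP2) : Prop :=
  IsMinimalLagrangian f u (fun z => -I * (lam : ℂ) ^ (-3 : ℤ) * ψ z)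

theorem toLin'_injective (A : Matrix.specialUnitaryGroup (Fin 3) ℂ) :
    Function.Injective (Matrix.toLin' (A : Matrix (Fin 3) (Fin 3) ℂ)) := by
  have h : star (A : Matrix (Fin 3) (Fin 3) ℂ) * (A : Matrix (Fin 3) (Fin 3) ℂ) = 1 :=
    (Matrix.mem_unitaryGroup_iff').1 (Matrix.mem_specialUnitaryGroup_iff.1 A.2).1
  intro v w hvw
  have h2 := congrArg (fun x => star (A : Matrix (Fin 3) (Fin 3) ℂ) *ᵥ x) hvw
  simpa [Matrix.toLin'_apply, Matrix.mulVec_mulVec, h] using h2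

/-- The isometry of `ℂP²` induced by an element of `SU(3)`. -/
noncomputable def su3Act (A : Matrix.specialUnitaryGroup (Fin 3) ℂ) : CP2 → CP2 :=
  Projectivization.map (Matrix.toLin' (A : Matrix (Fin 3) (Fin 3) ℂ)) (toLin'_injective A)

/-- `f(t + z) = R(t) f(z)` for a (continuous) one-parameter subgroup `R` of `SU(3)`. -/
def IsTranslationallyEquivariant (f : ℂ → CP2) : Prop :=
  ∃ R : Multiplicative ℝ →* Matrix.specialUnitaryGroup (Fin 3) ℂ,
    Continuous (fun t : ℝ => R (Multiplicative.ofAdd t)) ∧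
    ∀ (t : ℝ) (z : ℂ), f (t + z) = su3Act (R (Multiplicative.ofAdd t)) (f z)

/-- `f` is a cylinder relative to the (nontrivial) translation by `w`. -/
def IsCylinderRel (f : ℂ → CP2) (w : ℂ) : Prop :=
  w ≠ 0 ∧ ∀ z, f (z + w) = f z

/-- The potential matrix `D(lam) = 𝔽⁻¹ 𝔽_x |_{z = 0}`, where `𝔽(z, lam)` is the extended frame of
the associated family, with `a₁ = e^{u(0)}` and `u'(0) = 0`. -/
noncomputable def potential (a₁ : ℝ) (ψ lam : ℂ) : Matrix (Fin 3) (Fin 3) ℂ :=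
  !![0, -I * lam * (starRingEnd ℂ) ψ * (a₁ : ℂ)⁻¹, I * lam⁻¹ * (√a₁ : ℂ);
     -I * lam⁻¹ * ψ * (a₁ : ℂ)⁻¹, 0, I * lam * (√a₁ : ℂ);
     I * lam * (√a₁ : ℂ), I * lam⁻¹ * (√a₁ : ℂ), 0]

/-- `β = 2 a₁ + |ψ|² / a₁²`. -/
noncomputable def betaConst (a₁ : ℝ) (ψ : ℂ) : ℝ := 2 * a₁ + ‖ψ‖ ^ 2 / a₁ ^ 2

/-- `a₂`: besides `a₁`, the positive root `w` of `2 w³ - β w² + |ψ|² = 0`. -/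
noncomputable def aTwo (a₁ : ℝ) (ψ : ℂ) : ℝ :=
  ((betaConst a₁ ψ / 2 - a₁) +
    √((betaConst a₁ ψ / 2 - a₁) ^ 2 + 4 * a₁ * (betaConst a₁ ψ / 2 - a₁))) / 2

/-- `a₃`: minus the negative root `w` of `2 w³ - β w² + |ψ|² = 0`. -/
noncomputable def aThree (a₁ : ℝ) (ψ : ℂ) : ℝ :=
  (-(betaConst a₁ ψ / 2 - a₁) +
    √((betaConst a₁ ψ / 2 - a₁) ^ 2 + 4 * a₁ * (betaConst a₁ ψ / 2 - a₁))) / 2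

/-- The elliptic integral of the first kind `J(θ, k)`, as a function of `θ` and of `m = k²`. -/
noncomputable def ellipticJ (θ m : ℝ) : ℝ := ∫ α in (0 : ℝ)..θ, 1 / √(1 - m * Real.sin α ^ 2)

/-- `T = K / r`, where `K = J(π/2, k)` with `k² = (a₁ - a₂) / (a₁ + a₃)` and
`r = √(2 (a₁ + a₃))`; the metric has period `2 T` in `y`. -/
noncomputable def halfPeriod (a₁ : ℝ) (ψ : ℂ) : ℝ :=
  ellipticJ (Real.pi / 2) ((a₁ - aTwo a₁ ψ) / (a₁ + aThree a₁ ψ)) / √(2 * (a₁ + aThree a₁ ψ))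

/-- The common denominator `lam³ ψ̄ - lam⁻³ ψ - e^v v'` of the integrands of `β₁` and `β₂`, for a
function `v` of `y`. -/
noncomputable def betaDen (v : ℝ → ℝ) (ψ lam : ℂ) (s : ℝ) : ℂ :=
  lam ^ 3 * (starRingEnd ℂ) ψ - lam ^ (-3 : ℤ) * ψ - (Real.exp (v s) * deriv v s : ℝ)

/-- The integrand of `β₁`. -/
noncomputable def betaOneIntegrand (v : ℝ → ℝ) (ψ lam : ℂ) (s : ℝ) : ℂ :=
  (2 * I * lam ^ 3 * (starRingEnd ℂ) ψ - I * (deriv v s * Real.exp (v s) : ℝ)) / betaDen v ψ lam s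

/-- The integrand of `β₂`. -/
noncomputable def betaTwoIntegrand (v : ℝ → ℝ) (ψ lam : ℂ) (s : ℝ) : ℂ :=
  (2 * Real.exp (v s) : ℝ) / betaDen v ψ lam s

/-- `β₁(y, lam)`. -/
noncomputable def betaOne (v : ℝ → ℝ) (ψ lam : ℂ) (y : ℝ) : ℂ :=
  ∫ s in (0 : ℝ)..y, betaOneIntegrand v ψ lam s

/-- `β₂(y, lam)`. -/
noncomputable def betaTwo (v : ℝ → ℝ) (ψ lam : ℂ) (y : ℝ) : ℂ :=
  ∫ s in (0 : ℝ)..y, betaTwoIntegrand v ψ lam s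

/-- `B` is the Cauchy principal value of `∫₀^y g(s) ds`, where `g` is singular at the zeros of
`den`: the limit, as `ε → 0⁺`, of the integrals over `{s ∈ (0, y] : |den s| > ε}`. -/
def HasPrincipalValue (g den : ℝ → ℂ) (y : ℝ) (B : ℂ) : Prop :=
  Tendsto (fun ε : ℝ => ∫ s in {s : ℝ | s ∈ Set.Ioc 0 y ∧ ε < ‖den s‖}, g s) (𝓝[>] 0) (𝓝 B)

/-- `Re(B₁) d + Im(B₂) (-d² + 2β/3)` is a rational multiple of `2π`. -/
def ImagPeriodCondition (β : ℝ) (B₁ B₂ : ℂ) (d : ℝ) : Prop :=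
  ∃ r : ℚ, B₁.re * d + B₂.im * (-d ^ 2 + 2 * β / 3) = 2 * Real.pi * r

end MinLag

/-! The surface is studied through a horizontal lift `F` instead of an extended frame. Horizontal
lifts of one map differ by a unimodular constant (`horizontal_lift_unique`), so a real translation
acts on `F` by a unitary matrix. Hence e^u depends on y alone, and the Hopf differential, being
holomorphic, is constant. The Gauss equation and its first integral become w'' = 4βw − 12w² for w =
e^u on the imaginary axis; its solution is explicit in the Jacobi amplitude, which gives the period
2T.

The infinitesimal real translation is diagonalised on linear functionals. An eigenfunctional ℓ, a
mode, satisfies ℓ(F(x + z)) = e^{idx} ℓ(F(z)), and the numbers id are the eigenvalues of D(λ₀).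
Since a₂ < a₁ forces β³ > 27|ψ|², they are distinct, so three modes separate the points of ℂ³. A
translation then closes up in ℂP² exactly when it multiplies all modes by the same number
(`translation_closes_iff`). For a real translation p the multipliers are e^{i d_j p}; as the d_j sum
to 0, their agreement for some p ≠ 0 is rationality of d₁/d₂.

Along the imaginary axis g = ℓ ∘ F satisfies g'' = (d² − 4w)g and g'(2iS − w') = g(4w² − 2d²w −
2dR), where R + iS = λ₀⁻³ψ.

If S ≠ 0, the first order equation integrates to a multiplier exp Θ_j over one period. It is
unimodular because `F` is bounded, and Im Θ_j is, up to sign and a term independent of j, the left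
side of the stated period condition. These left sides sum to 0 over j, so the multipliers have a
common nonzero power exactly when they are rational multiples of 2π.

If S = 0, the first order equation is real and singular. It forces g to be proportional to its
conjugate, so the multiplier is real and unimodular, that is ±1, and two periods always close up.
The reflection s ↦ 2T − s makes the principal values a purely imaginary number and 0, so the period
condition holds trivially as well. -/

namespace MinLag

/-! ### Uniqueness for linear second order equations -/

/-- A solution of `g'' = c g` with bounded `c` and vanishing Cauchy data is zero. -/
theorem eq_zero_of_linear_second_order {c : ℝ → ℝ} {C : ℝ} (hc : ∀ y, |c y| ≤ C)
    {g g' : ℝ → ℂ} (hg : ∀ y, HasDerivAt g (g' y) y) (hg' : ∀ y, HasDerivAt g' (c y * g y) y)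
    {y₀ : ℝ} (h0 : g y₀ = 0) (h1 : g' y₀ = 0) (y : ℝ) : g y = 0 := by
  have hC : 0 ≤ C := (abs_nonneg _).trans (hc 0)
  have key := ODE_solution_unique_univ (K := (C + 1).toNNReal) (t₀ := y₀)
    (v := fun (t : ℝ) (p : ℂ × ℂ) => (p.2, (c t : ℂ) * p.1)) (s := fun _ => Set.univ)
    (f := fun t => (g t, g' t)) (g := fun _ => 0) ?_ ?_ ?_ ?_
  · exact congrArg Prod.fst (congrFun key y)
  · intro t
    refine LipschitzOnWith.of_dist_le_mul fun p _ q _ => ?_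
    rw [Real.coe_toNNReal _ (by linarith), Prod.dist_eq, Prod.dist_eq]
    have h2 : dist ((c t : ℂ) * p.1) (c t * q.1) ≤ C * dist p.1 q.1 := by
      rw [dist_eq_norm, ← mul_sub, norm_mul, dist_eq_norm, Complex.norm_real]
      exact mul_le_mul_of_nonneg_right (hc t) (norm_nonneg _)
    have h3 := le_max_left (dist p.1 q.1) (dist p.2 q.2)
    have h4 := le_max_right (dist p.1 q.1) (dist p.2 q.2)
    have h5 := dist_nonneg (x := p.1) (y := q.1)
    refine max_le ?_ ?_
    · nlinarith
    · nlinarith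
  · exact fun t => ⟨(hg t).prodMk (hg' t), trivial⟩
  · intro t
    refine ⟨?_, trivial⟩
    convert hasDerivAt_const t (0 : ℂ × ℂ) using 1
    ext <;> simp
  · simp [h0, h1]

/-! ### The elliptic integral and the Jacobi amplitude -/

section Elliptic

variable {m : ℝ}

theorem one_sub_mul_sin_sq_pos (h0 : 0 ≤ m) (h1 : m < 1) (θ : ℝ) :
    0 < 1 - m * Real.sin θ ^ 2 := by
  nlinarith [Real.sin_sq_le_one θ, sq_nonneg (Real.sin θ)]

theorem continuous_ellipticJ_integrand (h0 : 0 ≤ m) (h1 : m < 1) :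
    Continuous fun α : ℝ => 1 / √(1 - m * Real.sin α ^ 2) := by
  refine Continuous.div continuous_const (by fun_prop) fun α => ?_
  exact (Real.sqrt_pos.2 (one_sub_mul_sin_sq_pos h0 h1 α)).ne'

theorem hasDerivAt_ellipticJ (h0 : 0 ≤ m) (h1 : m < 1) (θ : ℝ) :
    HasDerivAt (fun t => ellipticJ t m) (1 / √(1 - m * Real.sin θ ^ 2)) θ :=
  (continuous_ellipticJ_integrand h0 h1).integral_hasStrictDerivAt 0 θ |>.hasDerivAt

theorem one_le_ellipticJ_integrand (h0 : 0 ≤ m) (h1 : m < 1) (θ : ℝ) :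
    1 ≤ 1 / √(1 - m * Real.sin θ ^ 2) := by
  rw [le_div_iff₀ (Real.sqrt_pos.2 (one_sub_mul_sin_sq_pos h0 h1 θ)), one_mul]
  refine Real.sqrt_le_one.2 ?_
  nlinarith [sq_nonneg (Real.sin θ)]

/-- The integrand is at least 1. This one comparison with the identity yields positivity, strict
monotonicity and surjectivity of the elliptic integral, hence a global inverse. -/
theorem monotone_ellipticJ_sub_id (h0 : 0 ≤ m) (h1 : m < 1) :
    Monotone fun t => ellipticJ t m - t := by
  have hd : ∀ t, HasDerivAt (fun t => ellipticJ t m - t) (1 / √(1 - m * Real.sin t ^ 2) - 1) t :=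
    fun t => (hasDerivAt_ellipticJ h0 h1 t).sub (hasDerivAt_id t)
  refine monotone_of_deriv_nonneg (fun t => (hd t).differentiableAt) fun t => ?_
  rw [(hd t).deriv]
  linarith [one_le_ellipticJ_integrand h0 h1 t]

@[simp] theorem ellipticJ_zero : ellipticJ 0 m = 0 := by simp [ellipticJ]

theorem ellipticJ_pos (h0 : 0 ≤ m) (h1 : m < 1) {θ : ℝ} (hθ : 0 < θ) : 0 < ellipticJ θ m := by
  have := monotone_ellipticJ_sub_id h0 h1 hθ.le
  simp only [ellipticJ_zero] at this
  linarith

theorem strictMono_ellipticJ (h0 : 0 ≤ m) (h1 : m < 1) : StrictMono fun t => ellipticJ t m := by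
  intro s t hst
  have := monotone_ellipticJ_sub_id h0 h1 hst.le
  simp only at this ⊢
  linarith

theorem continuous_ellipticJ (h0 : 0 ≤ m) (h1 : m < 1) : Continuous fun t => ellipticJ t m :=
  continuous_iff_continuousAt.2 fun t => (hasDerivAt_ellipticJ h0 h1 t).continuousAt

theorem surjective_ellipticJ (h0 : 0 ≤ m) (h1 : m < 1) :
    Function.Surjective fun t => ellipticJ t m := by
  refine (continuous_ellipticJ h0 h1).surjective ?_ ?_
  · refine tendsto_atTop_mono' _ ?_ tendsto_id
    filter_upwards [eventually_ge_atTop (0 : ℝ)] with t ht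
    have := monotone_ellipticJ_sub_id h0 h1 ht
    simp only [ellipticJ_zero] at this
    simp only [id]; linarith
  · refine tendsto_atBot_mono' _ ?_ tendsto_id
    filter_upwards [eventually_le_atBot (0 : ℝ)] with t ht
    have := monotone_ellipticJ_sub_id h0 h1 ht
    simp only [ellipticJ_zero] at this
    simp only [id]; linarith

/-- The integrand has period π and is symmetric about π/2. -/
theorem ellipticJ_add_pi (h0 : 0 ≤ m) (h1 : m < 1) (θ : ℝ) :
    ellipticJ (θ + Real.pi) m = ellipticJ θ m + 2 * ellipticJ (Real.pi / 2) m := by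
  have hint : ∀ a b, IntervalIntegrable (fun α : ℝ => 1 / √(1 - m * Real.sin α ^ 2)) volume a b :=
    fun a b => (continuous_ellipticJ_integrand h0 h1).intervalIntegrable a b
  have hper : Function.Periodic (fun α : ℝ => 1 / √(1 - m * Real.sin α ^ 2)) Real.pi := by
    intro α; simp [Real.sin_add_pi]
  have e1 := hper.intervalIntegral_add_eq θ 0
  have e2 : ∫ α in (Real.pi / 2)..Real.pi, 1 / √(1 - m * Real.sin α ^ 2)
      = ∫ α in (0 : ℝ)..(Real.pi / 2), 1 / √(1 - m * Real.sin α ^ 2) := by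
    have := intervalIntegral.integral_comp_sub_left (a := 0) (b := Real.pi / 2)
      (fun α : ℝ => 1 / √(1 - m * Real.sin α ^ 2)) Real.pi
    simp only [Real.sin_pi_sub, sub_zero] at this
    rw [this]; congr 1; ring
  have e3 := intervalIntegral.integral_add_adjacent_intervals (hint 0 (Real.pi / 2))
    (hint (Real.pi / 2) Real.pi)
  have e4 := intervalIntegral.integral_add_adjacent_intervals (hint 0 θ) (hint θ (θ + Real.pi))
  rw [zero_add] at e1
  unfold ellipticJ
  rw [← e4, e1, ← e3, e2]; ring

/-- The Jacobi amplitude: a solution of `φ' = r √(1 - m sin² φ)` with `φ(0) = 0`, advancing by `π`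
over the period. -/
theorem exists_amplitude (h0 : 0 ≤ m) (h1 : m < 1) {r : ℝ} (hr : 0 < r) :
    ∃ φ : ℝ → ℝ, φ 0 = 0 ∧ (∀ y, HasDerivAt φ (r * √(1 - m * Real.sin (φ y) ^ 2)) y) ∧
      ∀ y, φ (y + 2 * (ellipticJ (Real.pi / 2) m / r)) = φ y + Real.pi := by
  let e := StrictMono.orderIsoOfSurjective _ (strictMono_ellipticJ h0 h1)
    (surjective_ellipticJ h0 h1)
  have he : ∀ t, e t = ellipticJ t m := fun t => rfl
  have hd : ∀ y, HasDerivAt e.symm (√(1 - m * Real.sin (e.symm y) ^ 2)) y := by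
    intro y
    have := HasDerivAt.of_local_left_inverse (f := fun t => ellipticJ t m) (g := e.symm) (a := y)
      e.symm.continuous.continuousAt (hasDerivAt_ellipticJ h0 h1 (e.symm y))
      (by have := one_le_ellipticJ_integrand h0 h1 (e.symm y); positivity)
      (Eventually.of_forall fun z => e.apply_symm_apply z)
    simpa using this
  refine ⟨fun y => e.symm (r * y), ?_, fun y => ?_, fun y => ?_⟩
  · simp only [mul_zero]
    rw [OrderIso.symm_apply_eq, he, ellipticJ_zero]
  · have := (hd (r * y)).comp y ((hasDerivAt_id y).const_mul r)
    simp only [mul_one] at this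
    rw [mul_comm]
    exact this
  · simp only
    rw [OrderIso.symm_apply_eq, he, ellipticJ_add_pi h0 h1, ← he (e.symm _), e.apply_symm_apply]
    field_simp

end Elliptic

/-! ### The equation of the metric factor -/

/-- The difference of two solutions solves a linear equation with coefficient 4β − 12(w + W). The
bounds on both solutions make this coefficient bounded, so linear uniqueness applies. -/
theorem metric_ode_unique {β C C' : ℝ} {w w' W W' : ℝ → ℝ} (hw : ∀ y, HasDerivAt w (w' y) y)
    (hw' : ∀ y, HasDerivAt w' (4 * β * w y - 12 * w y ^ 2) y) (hW : ∀ y, HasDerivAt W (W' y) y)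
    (hW' : ∀ y, HasDerivAt W' (4 * β * W y - 12 * W y ^ 2) y) (hC : ∀ y, |w y| ≤ C)
    (hC' : ∀ y, |W y| ≤ C') (h0 : w 0 = W 0) (h0' : w' 0 = W' 0) (y : ℝ) : w y = W y := by
  have := eq_zero_of_linear_second_order (c := fun y => 4 * β - 12 * (w y + W y))
    (C := |4 * β| + 12 * (C + C')) ?_
    (g := fun y => ((w y - W y : ℝ) : ℂ)) (g' := fun y => ((w' y - W' y : ℝ) : ℂ)) ?_ ?_
    (y₀ := 0) ?_ ?_ y
  · exact sub_eq_zero.1 (by exact_mod_cast this)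
  · intro y
    refine (abs_sub _ _).trans ?_
    rw [abs_mul 12, abs_of_pos (by norm_num : (0 : ℝ) < 12)]
    linarith [abs_add_le (w y) (W y), hC y, hC' y]
  · exact fun y => ((hw y).sub (hW y)).ofReal_comp
  · intro y
    refine HasDerivAt.congr_deriv ((hw' y).sub (hW' y)).ofReal_comp ?_
    push_cast; ring
  · simp [h0]
  · simp [h0']

/-- The solution of `w'' = 4 β w - 12 w²` starting at rest from the largest root `a₁` is periodic
with the period given by the complete elliptic integral. -/
theorem periodic_of_metric_ode {a₁ a₂ a₃ β C : ℝ} (ha₂ : 0 < a₂) (ha₃ : 0 < a₃) (h12 : a₂ < a₁)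
    (hβ : β = 2 * (a₁ + a₂ - a₃)) (hrel : a₁ * a₂ = (a₁ + a₂) * a₃)
    {w w' : ℝ → ℝ} (hw : ∀ y, HasDerivAt w (w' y) y)
    (hw' : ∀ y, HasDerivAt w' (4 * β * w y - 12 * w y ^ 2) y)
    (hC : ∀ y, |w y| ≤ C) (h0 : w 0 = a₁) (h0' : w' 0 = 0) (y : ℝ) :
    w (y + 2 * (ellipticJ (Real.pi / 2) ((a₁ - a₂) / (a₁ + a₃)) / √(2 * (a₁ + a₃)))) = w y := by
  have hs : 0 < a₁ + a₃ := by linarith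
  have hm0 : 0 ≤ (a₁ - a₂) / (a₁ + a₃) := div_nonneg (by linarith) hs.le
  have hm1 : (a₁ - a₂) / (a₁ + a₃) < 1 := by rw [div_lt_one hs]; linarith
  have hr : 0 < √(2 * (a₁ + a₃)) := Real.sqrt_pos.2 (by linarith)
  obtain ⟨φ, hφ0, hφ, hper⟩ := exists_amplitude hm0 hm1 hr
  set m := (a₁ - a₂) / (a₁ + a₃) with hm
  set r := √(2 * (a₁ + a₃)) with hrdef
  have hr2 : r ^ 2 = 2 * (a₁ + a₃) := Real.sq_sqrt (by linarith)
  have hmr : m * r ^ 2 = 2 * (a₁ - a₂) := by rw [hr2, hm]; field_simp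
  set p : ℝ → ℝ := fun y => r * √(1 - m * Real.sin (φ y) ^ 2) with hp
  have hp2 : ∀ y, p y ^ 2 = 2 * (a₁ + a₃) - 2 * (a₁ - a₂) * Real.sin (φ y) ^ 2 := by
    intro y
    simp only [hp]
    rw [mul_pow, Real.sq_sqrt (one_sub_mul_sin_sq_pos hm0 hm1 _).le, mul_sub, hr2, ← hmr, hr2]
    ring
  have hsin : ∀ y, HasDerivAt (fun y => Real.sin (φ y)) (Real.cos (φ y) * p y) y :=
    fun y => (hφ y).sin
  have hcos : ∀ y, HasDerivAt (fun y => Real.cos (φ y)) (-Real.sin (φ y) * p y) y :=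
    fun y => (hφ y).cos
  have hpd : ∀ y, HasDerivAt p (-(2 * (a₁ - a₂)) * Real.sin (φ y) * Real.cos (φ y)) y := by
    intro y
    have hpos := one_sub_mul_sin_sq_pos hm0 hm1 (φ y)
    have hsq := Real.sqrt_pos.2 hpos
    have := ((((hsin y).pow 2).const_mul m).const_sub 1).sqrt hpos.ne' |>.const_mul r
    refine HasDerivAt.congr_deriv (show HasDerivAt p _ y from this) ?_
    simp only [hp, ← hmr, Pi.pow_apply]
    field_simp
    ring
  -- The classical sn² solution, oscillating between the roots a₁ and a₂; it depends on φ only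
  -- through sin², so an advance of φ by π is a period.
  set W : ℝ → ℝ := fun y => a₁ - (a₁ - a₂) * Real.sin (φ y) ^ 2 with hW
  set W' : ℝ → ℝ := fun y => -(a₁ - a₂) * (2 * Real.sin (φ y) * (Real.cos (φ y) * p y)) with hW'
  have hWd : ∀ y, HasDerivAt W (W' y) y := by
    intro y
    have := (((hsin y).pow 2).const_mul (a₁ - a₂)).const_sub a₁
    refine HasDerivAt.congr_deriv (show HasDerivAt W _ y from this) ?_
    simp only [hW']; push_cast; ring
  have hWd' : ∀ y, HasDerivAt W' (4 * β * W y - 12 * W y ^ 2) y := by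
    intro y
    have := (((hsin y).const_mul 2).mul ((hcos y).mul (hpd y))).const_mul (-(a₁ - a₂))
    refine HasDerivAt.congr_deriv (f := W') (f' := -(a₁ - a₂) * (2 * (Real.cos (φ y) * p y) *
      (Real.cos (φ y) * p y) + 2 * Real.sin (φ y) * (-Real.sin (φ y) * p y * p y +
      Real.cos (φ y) * (-(2 * (a₁ - a₂)) * Real.sin (φ y) * Real.cos (φ y))))) this ?_
    have hc2 : Real.cos (φ y) ^ 2 = 1 - Real.sin (φ y) ^ 2 := Real.cos_sq' _
    have hq := hp2 y
    simp only [hW, hβ]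
    set s := Real.sin (φ y)
    set c := Real.cos (φ y)
    set q := p y
    have e : -(a₁ - a₂) * (2 * (c * q) * (c * q) +
        2 * s * (-s * q * q + c * (-(2 * (a₁ - a₂)) * s * c)))
      = -(a₁ - a₂) * (2 * c ^ 2 * q ^ 2 - 2 * s ^ 2 * q ^ 2 - 4 * (a₁ - a₂) * s ^ 2 * c ^ 2) := by
      ring
    rw [e, hq, hc2]
    linear_combination (-4) * hrel
  have hWC : ∀ y, |W y| ≤ |a₁| + |a₁ - a₂| := by
    intro y
    refine (abs_sub _ _).trans ?_
    rw [abs_mul, abs_of_nonneg (sq_nonneg (Real.sin (φ y)))]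
    nlinarith [Real.sin_sq_le_one (φ y), abs_nonneg (a₁ - a₂)]
  have heq : ∀ y, w y = W y :=
    metric_ode_unique hw hw' hWd hWd' hC hWC (by simp [hW, hφ0, h0]) (by simp [hW', hφ0, h0'])
  rw [heq, heq]
  simp only [hW, hper y, Real.sin_add_pi, neg_sq]

/-! ### Hermitian algebra and orthogonal frames -/

section Herm

variable (Z W V : Fin 3 → ℂ) (c : ℂ)

theorem herm_eq_dotProduct : herm Z W = Z ⬝ᵥ star W := rfl

theorem herm_add_left : herm (Z + W) V = herm Z V + herm W V := by
  simp [herm_eq_dotProduct, add_dotProduct]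

theorem herm_add_right : herm V (Z + W) = herm V Z + herm V W := by
  simp [herm_eq_dotProduct, dotProduct_add]

theorem herm_sub_left : herm (Z - W) V = herm Z V - herm W V := by
  simp [herm_eq_dotProduct, sub_dotProduct]

theorem herm_sub_right : herm V (Z - W) = herm V Z - herm V W := by
  simp [herm_eq_dotProduct, dotProduct_sub]

theorem herm_smul_left : herm (c • Z) W = c * herm Z W := by
  simp [herm_eq_dotProduct, smul_dotProduct]

theorem herm_smul_right : herm Z (c • W) = (starRingEnd ℂ) c * herm Z W := by
  simp [herm_eq_dotProduct, dotProduct_smul]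

theorem conj_herm : (starRingEnd ℂ) (herm Z W) = herm W Z := by
  simp [herm, map_sum, mul_comm]

theorem herm_self_ofReal : herm Z Z = ((∑ k, ‖Z k‖ ^ 2 : ℝ) : ℂ) := by
  simp [herm, Complex.mul_conj, Complex.normSq_eq_norm_sq]

theorem norm_apply_le_one {Z : Fin 3 → ℂ} (h : herm Z Z = 1) (k : Fin 3) : ‖Z k‖ ≤ 1 := by
  rw [herm_self_ofReal] at h
  have h' : ∑ k, ‖Z k‖ ^ 2 = 1 := by exact_mod_cast h
  have := Finset.single_le_sum (f := fun k => ‖Z k‖ ^ 2) (fun _ _ => by positivity)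
    (Finset.mem_univ k)
  nlinarith [norm_nonneg (Z k)]

/-- Expansion of a vector in an orthogonal frame with square norms `E, E, 1`. -/
theorem frame_expansion {a b c : Fin 3 → ℂ} {E : ℂ} (hE : E ≠ 0) (haa : herm a a = E)
    (hbb : herm b b = E) (hcc : herm c c = 1) (hab : herm a b = 0) (hac : herm a c = 0)
    (hbc : herm b c = 0) (V : Fin 3 → ℂ) :
    V = (herm V a / E) • a + (herm V b / E) • b + herm V c • c := by
  have hba : herm b a = 0 := by rw [← conj_herm, hab, map_zero]
  have hca : herm c a = 0 := by rw [← conj_herm, hac, map_zero]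
  have hcb : herm c b = 0 := by rw [← conj_herm, hbc, map_zero]
  obtain ⟨M, hM0, hM1, hM2⟩ : ∃ M : Matrix (Fin 3) (Fin 3) ℂ, M 0 = a ∧ M 1 = b ∧ M 2 = c :=
    ⟨Matrix.of ![a, b, c], rfl, rfl, rfl⟩
  have h1 : M * Mᴴ = Matrix.diagonal ![E, E, 1] := by
    ext i j
    have : (M * Mᴴ) i j = herm (M i) (M j) := by
      simp [Matrix.mul_apply, herm]
    rw [this]
    fin_cases i <;> fin_cases j <;>
      simp [hM0, hM1, hM2, haa, hbb, hcc, hab, hac, hbc, hba, hca, hcb]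
  have h2 : M * (Mᴴ * Matrix.diagonal ![E⁻¹, E⁻¹, 1]) = 1 := by
    rw [← Matrix.mul_assoc, h1, Matrix.diagonal_mul_diagonal, ← Matrix.diagonal_one]
    congr 1
    ext i
    fin_cases i <;> simp [hE]
  -- A one-sided inverse of a square matrix is two-sided; here orthogonality of the frame turns into
  -- spanning.
  have h3 := mul_eq_one_comm.1 h2
  have h4 : V = V ᵥ* ((Mᴴ * Matrix.diagonal ![E⁻¹, E⁻¹, 1]) * M) := by rw [h3, Matrix.vecMul_one]
  have h5 : V ᵥ* Mᴴ = ![herm V a, herm V b, herm V c] := by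
    ext i
    have : (V ᵥ* Mᴴ) i = herm V (M i) := by
      simp [Matrix.vecMul, dotProduct, herm]
    rw [this]
    fin_cases i <;> simp [hM0, hM1, hM2]
  rw [← Matrix.vecMul_vecMul, ← Matrix.vecMul_vecMul, h5] at h4
  conv_lhs => rw [h4]
  ext i
  simp [Matrix.vecMul, dotProduct, Fin.sum_univ_three, hM0, hM1, hM2, Matrix.diagonal,
    div_eq_mul_inv]

end Herm

/-! ### Wirtinger calculus for vector-valued maps -/

section Wirtinger

variable {E : Type*} [NormedAddCommGroup E] [NormedSpace ℂ E]

/-- The Wirtinger derivative `∂/∂z` of a map into a complex normed space. -/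
noncomputable def wz (F : ℂ → E) (z : ℂ) : E :=
  (1 / 2 : ℂ) • (fderiv ℝ F z 1 - I • fderiv ℝ F z I)

/-- The Wirtinger derivative `∂/∂z̄` of a map into a complex normed space. -/
noncomputable def wzbar (F : ℂ → E) (z : ℂ) : E :=
  (1 / 2 : ℂ) • (fderiv ℝ F z 1 + I • fderiv ℝ F z I)

theorem fderiv_one_eq (F : ℂ → E) (z : ℂ) : fderiv ℝ F z 1 = wz F z + wzbar F z := by
  unfold wz wzbar; module

theorem fderiv_I_eq (F : ℂ → E) (z : ℂ) : fderiv ℝ F z I = I • (wz F z - wzbar F z) := by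
  have : I • (wz F z - wzbar F z) = (-(I * I)) • fderiv ℝ F z I := by
    unfold wz wzbar; module
  rw [this, I_mul_I, neg_neg, one_smul]

theorem contDiff_fderiv_apply {F : ℂ → E} (hF : ContDiff ℝ ∞ F) (v : ℂ) :
    ContDiff ℝ ∞ fun z => fderiv ℝ F z v :=
  (hF.fderiv_right (m := ∞) (by simp)).clm_apply contDiff_const

theorem contDiff_wz {F : ℂ → E} (hF : ContDiff ℝ ∞ F) : ContDiff ℝ ∞ (wz F) :=
  ((contDiff_fderiv_apply hF 1).sub ((contDiff_fderiv_apply hF I).const_smul I)).const_smul _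

theorem contDiff_wzbar {F : ℂ → E} (hF : ContDiff ℝ ∞ F) : ContDiff ℝ ∞ (wzbar F) :=
  ((contDiff_fderiv_apply hF 1).add ((contDiff_fderiv_apply hF I).const_smul I)).const_smul _

theorem fderiv_fderiv_apply {F : ℂ → E} (hF : ContDiff ℝ ∞ F) (v w z : ℂ) :
    fderiv ℝ (fun z => fderiv ℝ F z v) z w = fderiv ℝ (fderiv ℝ F) z w v := by
  have h : DifferentiableAt ℝ (fderiv ℝ F) z :=
    ((hF.fderiv_right (m := ∞) (by simp)).differentiable (by simp)) z
  rw [fderiv_clm_apply h (differentiableAt_const v)]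
  simp

theorem fderiv_fderiv_comm {F : ℂ → E} (hF : ContDiff ℝ ∞ F) (v w z : ℂ) :
    fderiv ℝ (fun z => fderiv ℝ F z v) z w = fderiv ℝ (fun z => fderiv ℝ F z w) z v := by
  rw [fderiv_fderiv_apply hF, fderiv_fderiv_apply hF]
  have := (hF.contDiffAt (x := z)).isSymmSndFDerivAt
    (by simp; exact WithTop.coe_le_coe.2 (le_top : (2 : ℕ∞) ≤ ⊤))
  exact this w v

theorem fderiv_wz {F : ℂ → E} (hF : ContDiff ℝ ∞ F) (v z : ℂ) :
    fderiv ℝ (wz F) z v = wz (fun z => fderiv ℝ F z v) z := by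
  have h1 := (contDiff_fderiv_apply hF 1).differentiable (by simp) z
  have hI := (contDiff_fderiv_apply hF I).differentiable (by simp) z
  have : HasFDerivAt (wz F) _ z :=
    (h1.hasFDerivAt.sub (hI.hasFDerivAt.const_smul I)).const_smul (1 / 2 : ℂ)
  rw [this.fderiv]
  simp only [wz, _root_.smul_apply, _root_.sub_apply]
  rw [fderiv_fderiv_comm hF 1 v, fderiv_fderiv_comm hF I v]

theorem fderiv_wzbar {F : ℂ → E} (hF : ContDiff ℝ ∞ F) (v z : ℂ) :
    fderiv ℝ (wzbar F) z v = wzbar (fun z => fderiv ℝ F z v) z := by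
  have h1 := (contDiff_fderiv_apply hF 1).differentiable (by simp) z
  have hI := (contDiff_fderiv_apply hF I).differentiable (by simp) z
  have : HasFDerivAt (wzbar F) _ z :=
    (h1.hasFDerivAt.add (hI.hasFDerivAt.const_smul I)).const_smul (1 / 2 : ℂ)
  rw [this.fderiv]
  simp only [wzbar, _root_.smul_apply, _root_.add_apply]
  rw [fderiv_fderiv_comm hF 1 v, fderiv_fderiv_comm hF I v]

theorem wz_wzbar_comm {F : ℂ → E} (hF : ContDiff ℝ ∞ F) (z : ℂ) :
    wz (wzbar F) z = wzbar (wz F) z := by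
  conv_lhs => unfold wz
  conv_rhs => unfold wzbar
  rw [fderiv_wzbar hF, fderiv_wzbar hF, fderiv_wz hF, fderiv_wz hF]
  simp only [wz, wzbar]
  rw [fderiv_fderiv_comm hF 1 I]
  module

theorem fderiv_herm {A B : ℂ → Fin 3 → ℂ} {z : ℂ} (hA : DifferentiableAt ℝ A z)
    (hB : DifferentiableAt ℝ B z) (v : ℂ) :
    fderiv ℝ (fun z => herm (A z) (B z)) z v =
      herm (fderiv ℝ A z v) (B z) + herm (A z) (fderiv ℝ B z v) := by
  have hk : ∀ k ∈ (Finset.univ : Finset (Fin 3)), HasFDerivAt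
      (fun z => A z k * (starRingEnd ℂ) (B z k)) _ z := fun k _ =>
    ((hasFDerivAt_pi'.1 hA.hasFDerivAt k).mul
      (Complex.conjCLE.hasFDerivAt.comp z (hasFDerivAt_pi'.1 hB.hasFDerivAt k)))
  have := HasFDerivAt.fun_sum hk
  unfold herm
  rw [this.fderiv]
  simp [Fin.sum_univ_three]
  ring

theorem wz_herm {A B : ℂ → Fin 3 → ℂ} {z : ℂ} (hA : DifferentiableAt ℝ A z)
    (hB : DifferentiableAt ℝ B z) :
    wz (fun z => herm (A z) (B z)) z = herm (wz A z) (B z) + herm (A z) (wzbar B z) := by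
  simp only [wz, wzbar]
  rw [fderiv_herm hA hB, fderiv_herm hA hB]
  simp only [herm_smul_left, herm_smul_right, herm_sub_left, herm_add_right, smul_eq_mul, map_div₀,
    map_one, map_ofNat, conj_I]
  ring

theorem wzbar_herm {A B : ℂ → Fin 3 → ℂ} {z : ℂ} (hA : DifferentiableAt ℝ A z)
    (hB : DifferentiableAt ℝ B z) :
    wzbar (fun z => herm (A z) (B z)) z = herm (wzbar A z) (B z) + herm (A z) (wz B z) := by
  simp only [wz, wzbar]
  rw [fderiv_herm hA hB, fderiv_herm hA hB]
  simp only [herm_smul_left, herm_smul_right, herm_sub_right, herm_add_left, smul_eq_mul, map_div₀,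
    map_one, map_ofNat, conj_I]
  ring

theorem wz_smul {a : ℂ → ℂ} {F : ℂ → E} {z : ℂ} (ha : DifferentiableAt ℝ a z)
    (hF : DifferentiableAt ℝ F z) :
    wz (fun z => a z • F z) z = wz a z • F z + a z • wz F z := by
  have := (ha.hasFDerivAt.smul hF.hasFDerivAt).fderiv
  simp only [wz]
  rw [show (fun z => a z • F z) = a • F from rfl, this]
  simp
  module

@[simp] theorem wz_const (c : E) (z : ℂ) : wz (fun _ => c) z = 0 := by simp [wz]

@[simp] theorem wzbar_const (c : E) (z : ℂ) : wzbar (fun _ => c) z = 0 := by simp [wzbar]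

end Wirtinger

theorem fderiv_ofReal_comp {e : ℂ → ℝ} (he : Differentiable ℝ e) (z v : ℂ) :
    fderiv ℝ (fun z => (e z : ℂ)) z v = (fderiv ℝ e z v : ℝ) := by
  have := (Complex.ofRealCLM.hasFDerivAt.comp z (he z).hasFDerivAt).fderiv
  rw [show (fun z => (e z : ℂ)) = Complex.ofRealCLM ∘ e from rfl, this]
  rfl

/-! ### Structure equations of a minimal Lagrangian lift -/

/-- The defining equations of a horizontal lift of a conformal minimal Lagrangian immersion with
metric `2 e dz dz̄` and Hopf differential `Ψ dz³`. -/
structure IsMinimalLift (F : ℂ → Fin 3 → ℂ) (e : ℂ → ℝ) (Ψ : ℂ → ℂ) : Prop where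
  smooth : ContDiff ℝ ∞ F
  norm_one : ∀ z, herm (F z) (F z) = 1
  horizontal : ∀ z, herm (wz F z) (F z) = 0
  horizontal' : ∀ z, herm (wzbar F z) (F z) = 0
  pos : ∀ z, 0 < e z
  metric : ∀ z, herm (wz F z) (wz F z) = e z
  metric' : ∀ z, herm (wzbar F z) (wzbar F z) = e z
  conformal : ∀ z, herm (wz F z) (wzbar F z) = 0
  minimal : ∀ z, ∃ c : ℂ, wzbar (wz F) z = c • F z
  hopf : ∀ z, Ψ z = herm (wz (wz F) z) (wzbar F z)

namespace IsMinimalLift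

variable {F : ℂ → Fin 3 → ℂ} {e : ℂ → ℝ} {Ψ : ℂ → ℂ}

theorem differentiableAt (h : IsMinimalLift F e Ψ) (z : ℂ) : DifferentiableAt ℝ F z :=
  h.smooth.differentiable (by simp) z

theorem differentiableAt_wz (h : IsMinimalLift F e Ψ) (z : ℂ) : DifferentiableAt ℝ (wz F) z :=
  (contDiff_wz h.smooth).differentiable (by simp) z

theorem differentiableAt_wzbar (h : IsMinimalLift F e Ψ) (z : ℂ) :
    DifferentiableAt ℝ (wzbar F) z :=
  (contDiff_wzbar h.smooth).differentiable (by simp) z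

theorem expansion (h : IsMinimalLift F e Ψ) (z : ℂ) (V : Fin 3 → ℂ) :
    V = (herm V (wz F z) / e z) • wz F z + (herm V (wzbar F z) / e z) • wzbar F z
      + herm V (F z) • F z :=
  frame_expansion (ofReal_ne_zero.2 (h.pos z).ne') (h.metric z) (h.metric' z) (h.norm_one z)
    (h.conformal z) (h.horizontal z) (h.horizontal' z) V

theorem contDiff_metric (h : IsMinimalLift F e Ψ) : ContDiff ℝ ∞ e := by
  have : e = fun z => ∑ k, ‖wz F z k‖ ^ 2 := by
    funext z
    have := h.metric z
    rw [herm_self_ofReal] at this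
    exact_mod_cast this.symm
  rw [this]
  exact ContDiff.sum fun k _ => (contDiff_pi.1 (contDiff_wz h.smooth) k).norm_sq ℝ

theorem contDiff_ofReal_metric (h : IsMinimalLift F e Ψ) :
    ContDiff ℝ ∞ fun z => (e z : ℂ) :=
  Complex.ofRealCLM.contDiff.comp h.contDiff_metric

theorem conformal' (h : IsMinimalLift F e Ψ) (z : ℂ) : herm (wzbar F z) (wz F z) = 0 := by
  rw [← conj_herm, h.conformal, map_zero]

/-- Minimality gives proportionality to `F`; differentiating the horizontality relation F_z · F̄ = 0
in z̄ identifies the factor. -/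
theorem wzbar_wz (h : IsMinimalLift F e Ψ) (z : ℂ) : wzbar (wz F) z = -(e z : ℂ) • F z := by
  obtain ⟨c, hc⟩ := h.minimal z
  have h1 := wzbar_herm (h.differentiableAt_wz z) (h.differentiableAt z)
  rw [funext h.horizontal, wzbar_const, hc, herm_smul_left, h.norm_one, h.metric] at h1
  rw [hc]
  congr 1
  linear_combination -h1

theorem wz_wzbar (h : IsMinimalLift F e Ψ) (z : ℂ) : wz (wzbar F) z = -(e z : ℂ) • F z := by
  rw [wz_wzbar_comm h.smooth, h.wzbar_wz]

theorem herm_wz_wz (h : IsMinimalLift F e Ψ) (z : ℂ) :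
    herm (wz (wz F) z) (wz F z) = wz (fun z => (e z : ℂ)) z := by
  have h1 := wz_herm (h.differentiableAt_wz z) (h.differentiableAt_wz z)
  rw [funext h.metric, h.wzbar_wz, herm_smul_right, h.horizontal, mul_zero, add_zero] at h1
  exact h1.symm

theorem herm_wz_wz_self (h : IsMinimalLift F e Ψ) (z : ℂ) :
    herm (wz (wz F) z) (F z) = 0 := by
  have h1 := wz_herm (h.differentiableAt_wz z) (h.differentiableAt z)
  rw [funext h.horizontal, wz_const, h.conformal, add_zero] at h1
  exact h1.symm

theorem herm_wzbar_wzbar (h : IsMinimalLift F e Ψ) (z : ℂ) :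
    herm (wzbar (wzbar F) z) (wzbar F z) = wzbar (fun z => (e z : ℂ)) z := by
  have h1 := wzbar_herm (h.differentiableAt_wzbar z) (h.differentiableAt_wzbar z)
  rw [funext h.metric', h.wz_wzbar, herm_smul_right, h.horizontal', mul_zero, add_zero] at h1
  exact h1.symm

theorem herm_wzbar_wzbar_self (h : IsMinimalLift F e Ψ) (z : ℂ) :
    herm (wzbar (wzbar F) z) (F z) = 0 := by
  have h1 := wzbar_herm (h.differentiableAt_wzbar z) (h.differentiableAt z)
  rw [funext h.horizontal', wzbar_const, h.conformal', add_zero] at h1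
  exact h1.symm

theorem herm_wzbar_wzbar_wz (h : IsMinimalLift F e Ψ) (z : ℂ) :
    herm (wzbar (wzbar F) z) (wz F z) = -(starRingEnd ℂ) (Ψ z) := by
  have h1 := wzbar_herm (h.differentiableAt_wzbar z) (h.differentiableAt_wz z)
  rw [funext h.conformal', wzbar_const] at h1
  rw [h.hopf, conj_herm]
  linear_combination -h1

theorem wz_wz (h : IsMinimalLift F e Ψ) (z : ℂ) :
    wz (wz F) z = (wz (fun z => (e z : ℂ)) z / e z) • wz F z + (Ψ z / e z) • wzbar F z := by
  conv_lhs => rw [h.expansion z (wz (wz F) z)]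
  rw [h.herm_wz_wz, h.herm_wz_wz_self, ← h.hopf, zero_smul, add_zero]

theorem wzbar_wzbar (h : IsMinimalLift F e Ψ) (z : ℂ) :
    wzbar (wzbar F) z = (-(starRingEnd ℂ) (Ψ z) / e z) • wz F z
      + (wzbar (fun z => (e z : ℂ)) z / e z) • wzbar F z := by
  conv_lhs => rw [h.expansion z (wzbar (wzbar F) z)]
  rw [h.herm_wzbar_wzbar, h.herm_wzbar_wzbar_self, h.herm_wzbar_wzbar_wz, zero_smul, add_zero]

theorem wzbar_wz_wz (h : IsMinimalLift F e Ψ) (z : ℂ) :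
    wzbar (wz (wz F)) z = -(wz (fun z => (e z : ℂ)) z) • F z - (e z : ℂ) • wz F z := by
  rw [← wz_wzbar_comm (contDiff_wz h.smooth), show wzbar (wz F) = fun z => (-(e z : ℂ)) • F z from
    funext h.wzbar_wz, wz_smul ((h.contDiff_ofReal_metric.neg).differentiable (by simp) z)
    (h.differentiableAt z)]
  have : wz (fun z => -(e z : ℂ)) z = -wz (fun z => (e z : ℂ)) z := by
    simp only [wz]
    rw [fderiv_fun_neg]
    simp
    ring
  rw [this]
  module

/-- The Hopf differential of a minimal Lagrangian immersion is holomorphic. -/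
theorem wzbar_hopf (h : IsMinimalLift F e Ψ) (z : ℂ) : wzbar Ψ z = 0 := by
  rw [show Ψ = fun z => herm (wz (wz F) z) (wzbar F z) from funext h.hopf,
    wzbar_herm ((contDiff_wz (contDiff_wz h.smooth)).differentiable (by simp) z)
      (h.differentiableAt_wzbar z), h.wz_wzbar, h.wzbar_wz_wz, herm_smul_right,
    h.herm_wz_wz_self, herm_sub_left, herm_smul_left, herm_smul_left, h.conformal,
    ← conj_herm (wzbar F z), h.horizontal']
  simp

theorem contDiff_hopf (h : IsMinimalLift F e Ψ) : ContDiff ℝ ∞ Ψ := by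
  rw [show Ψ = fun z => herm (wz (wz F) z) (wzbar F z) from funext h.hopf]
  refine ContDiff.sum fun k _ => ?_
  exact (contDiff_pi.1 (contDiff_wz (contDiff_wz h.smooth)) k).mul
    (Complex.conjCLE.contDiff.comp (contDiff_pi.1 (contDiff_wzbar h.smooth) k))

theorem conj_wz_metric (e : ℂ → ℝ) (he : Differentiable ℝ e) (z : ℂ) :
    (starRingEnd ℂ) (wz (fun z => (e z : ℂ)) z) = wzbar (fun z => (e z : ℂ)) z := by
  simp only [wz, wzbar, fderiv_ofReal_comp he]
  simp [map_ofNat (starRingEnd ℂ) 2]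

/-- The Gauss equation. -/
theorem gauss (h : IsMinimalLift F e Ψ) (z : ℂ) :
    e z * wzbar (wz fun z => (e z : ℂ)) z = -(e z : ℂ) ^ 3 +
      wz (fun z => (e z : ℂ)) z * wzbar (fun z => (e z : ℂ)) z
        + Ψ z * (starRingEnd ℂ) (Ψ z) := by
  have he := ofReal_ne_zero.2 (h.pos z).ne'
  have h1 := wzbar_herm ((contDiff_wz (contDiff_wz h.smooth)).differentiable (by simp) z)
    (h.differentiableAt_wz z)
  rw [funext h.herm_wz_wz, h.wzbar_wz_wz, herm_sub_left, herm_smul_left, herm_smul_left,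
    h.metric, ← conj_herm (wz F z), h.horizontal, map_zero, mul_zero] at h1
  -- The remaining term |F_zz|² is read off from the expansion of F_zz in the frame.
  have h2 : herm (wz (wz F) z) (wz (wz F) z) = wz (fun z => (e z : ℂ)) z / e z *
      wzbar (fun z => (e z : ℂ)) z + Ψ z / e z * (starRingEnd ℂ) (Ψ z) := by
    conv_lhs => enter [1]; rw [h.wz_wz]
    rw [herm_add_left, herm_smul_left, herm_smul_left, ← conj_herm (wz (wz F) z) (wz F z),
      h.herm_wz_wz, ← conj_herm (wz (wz F) z) (wzbar F z), ← h.hopf,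
      conj_wz_metric e (h.contDiff_metric.differentiable (by simp))]
  rw [h1, h2]
  field_simp
  ring

end IsMinimalLift

/-! ### Restriction to lines and uniqueness of horizontal lifts -/

section Lines

variable {E : Type*} [NormedAddCommGroup E] [NormedSpace ℝ E]

theorem hasDerivAt_line {G : ℂ → E} (hG : Differentiable ℝ G) (z v : ℂ) (t : ℝ) :
    HasDerivAt (fun s : ℝ => G (s * v + z)) (fderiv ℝ G (t * v + z) v) t := by
  have h1 : HasDerivAt (fun s : ℝ => (s : ℂ) * v + z) v t := by
    simpa using ((Complex.ofRealCLM.hasDerivAt (x := t)).mul_const v).add_const z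
  exact (hG _).hasFDerivAt.comp_hasDerivAt t h1

theorem hasDerivAt_imag {G : ℂ → E} (hG : Differentiable ℝ G) (y : ℝ) :
    HasDerivAt (fun s : ℝ => G (s * I)) (fderiv ℝ G (y * I) I) y := by
  simpa using hasDerivAt_line hG 0 I y

theorem fderiv_one_eq_zero {G : ℂ → E} (hG : Differentiable ℝ G)
    (h : ∀ (t : ℝ) z, G (t + z) = G z) (z : ℂ) : fderiv ℝ G z 1 = 0 := by
  have h1 := hasDerivAt_line hG z 1 0
  simp only [mul_one, h, ofReal_zero, zero_add] at h1
  exact h1.unique (hasDerivAt_const _ _)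

theorem fderiv_apply_eq (L : ℂ →L[ℝ] E) (v : ℂ) : L v = v.re • L 1 + v.im • L I := by
  conv_lhs => rw [← re_add_im v]
  rw [map_add, ← real_smul, ← mul_one (v.re : ℂ), ← real_smul, map_smul, map_smul]

end Lines

theorem IsMinimalLift.herm_fderiv {F : ℂ → Fin 3 → ℂ} {e : ℂ → ℝ} {Ψ : ℂ → ℂ}
    (h : IsMinimalLift F e Ψ) (z v : ℂ) : herm (fderiv ℝ F z v) (F z) = 0 := by
  rw [fderiv_apply_eq, ← Complex.coe_smul, ← Complex.coe_smul, herm_add_left, herm_smul_left,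
    herm_smul_left, fderiv_one_eq, fderiv_I_eq, herm_smul_left, herm_add_left, herm_sub_left,
    h.horizontal, h.horizontal']
  simp

/-- Two horizontal unit lifts of the same map differ by a constant factor. -/
theorem horizontal_lift_unique {F H : ℂ → Fin 3 → ℂ} (hF : Differentiable ℝ F)
    (hH : Differentiable ℝ H) (nF : ∀ z, herm (F z) (F z) = 1) (nH : ∀ z, herm (H z) (H z) = 1)
    (horF : ∀ z v, herm (fderiv ℝ F z v) (F z) = 0)
    (horH : ∀ z v, herm (fderiv ℝ H z v) (H z) = 0) (hc : ∀ z, ∃ c : ℂ, H z = c • F z) :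
    ∃ c : ℂ, c * (starRingEnd ℂ) c = 1 ∧ ∀ z, H z = c • F z := by
  have key : ∀ z, H z = herm (H z) (F z) • F z := by
    intro z
    obtain ⟨c, hc⟩ := hc z
    rw [hc, herm_smul_left, nF, mul_one]
  have hunit : ∀ z, herm (H z) (F z) * (starRingEnd ℂ) (herm (H z) (F z)) = 1 := by
    intro z
    have := nH z
    rw [key z, herm_smul_left, herm_smul_right, nF, mul_one] at this
    exact this
  have hF' : ∀ z, F z = (starRingEnd ℂ) (herm (H z) (F z)) • H z := by
    intro z
    conv_rhs => rw [key z]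
    rw [smul_smul, herm_smul_left, nF, mul_one, mul_comm, hunit, one_smul]
  have hdiff : Differentiable ℝ fun z => herm (H z) (F z) := by
    unfold herm
    refine Differentiable.fun_sum fun k _ => ?_
    exact (differentiable_pi.1 hH k).mul
      (Complex.conjCLE.differentiable.comp (differentiable_pi.1 hF k))
  -- Each lift is a multiple of the other, so both terms in the derivative of their product vanish
  -- by horizontality.
  have hconst := is_const_of_fderiv_eq_zero hdiff fun z => by
    ext1 v
    rw [fderiv_herm (hH z) (hF z)]
    have e1 : herm (fderiv ℝ H z v) (F z) = 0 := by
      rw [hF' z, herm_smul_right, horH, mul_zero]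
    have e2 : herm (H z) (fderiv ℝ F z v) = 0 := by
      rw [key z, herm_smul_left, ← conj_herm (fderiv ℝ F z v), horF, map_zero, mul_zero]
    rw [e1, e2, add_zero]
    rfl
  exact ⟨herm (H 0) (F 0), hunit 0, fun z => by rw [hconst 0 z]; exact key z⟩

theorem herm_mulVec {A : Matrix (Fin 3) (Fin 3) ℂ} (hA : Aᴴ * A = 1) (v w : Fin 3 → ℂ) :
    herm (A *ᵥ v) (A *ᵥ w) = herm v w := by
  rw [herm_eq_dotProduct, herm_eq_dotProduct, Matrix.star_mulVec, dotProduct_comm,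
    ← Matrix.dotProduct_mulVec, Matrix.mulVec_mulVec, hA, Matrix.one_mulVec, dotProduct_comm]

theorem fderiv_mulVec (A : Matrix (Fin 3) (Fin 3) ℂ) {F : ℂ → Fin 3 → ℂ} {z : ℂ}
    (hF : DifferentiableAt ℝ F z) (v : ℂ) :
    fderiv ℝ (fun z => A *ᵥ F z) z v = A *ᵥ fderiv ℝ F z v := by
  have h : HasFDerivAt (fun z => A *ᵥ F z)
      (((Matrix.mulVecLin A).toContinuousLinearMap.restrictScalars ℝ).comp (fderiv ℝ F z)) z :=
    (((Matrix.mulVecLin A).toContinuousLinearMap.restrictScalars ℝ).hasFDerivAt).comp z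
      hF.hasFDerivAt
  rw [h.fderiv]
  rfl

theorem differentiable_mulVec (A : Matrix (Fin 3) (Fin 3) ℂ) {F : ℂ → Fin 3 → ℂ}
    (hF : Differentiable ℝ F) : Differentiable ℝ fun z => A *ᵥ F z := fun z =>
  (((Matrix.mulVecLin A).toContinuousLinearMap.restrictScalars ℝ).differentiableAt).comp z (hF z)

/-- `S` translates `F` by `t` along the real axis. -/
def IsTranslator (F : ℂ → Fin 3 → ℂ) (t : ℝ) (S : Matrix (Fin 3) (Fin 3) ℂ) : Prop :=
  Sᴴ * S = 1 ∧ ∀ z, F (t + z) = S *ᵥ F z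

/-! ### Consequences of translational symmetry -/

section Lift

variable {F : ℂ → Fin 3 → ℂ} {e : ℂ → ℝ} {Ψ : ℂ → ℂ} {f : ℂ → CP2}

theorem exists_smul_of_eq (hl : ∀ z, ∃ h : F z ≠ 0, f z = Projectivization.mk ℂ (F z) h)
    {z z' : ℂ} (h : f z = f z') : ∃ c : ℂ, F z = c • F z' := by
  obtain ⟨h1, e1⟩ := hl z
  obtain ⟨h2, e2⟩ := hl z'
  rw [e1, e2, Projectivization.mk_eq_mk_iff'] at h
  obtain ⟨c, hc⟩ := h
  exact ⟨c, hc.symm⟩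

/-- The translate of `F` and its image under R(t) are horizontal lifts of the same map, hence agree
up to a unimodular factor. That factor is absorbed into `S`, which is therefore only unitary. -/
theorem IsMinimalLift.exists_translator (h : IsMinimalLift F e Ψ)
    (hl : ∀ z, ∃ h : F z ≠ 0, f z = Projectivization.mk ℂ (F z) h)
    (hequiv : IsTranslationallyEquivariant f) (t : ℝ) : ∃ S, IsTranslator F t S := by
  obtain ⟨R, -, hR⟩ := hequiv
  set A := R (Multiplicative.ofAdd t)
  have hA : (A : Matrix (Fin 3) (Fin 3) ℂ)ᴴ * A = 1 :=
    (Matrix.mem_unitaryGroup_iff').1 (Matrix.mem_specialUnitaryGroup_iff.1 A.2).1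
  have hF : Differentiable ℝ F := fun z => h.differentiableAt z
  obtain ⟨c, hc, hcF⟩ := horizontal_lift_unique (F := fun z => (A : Matrix _ _ ℂ) *ᵥ F z)
    (H := fun z => F (t + z)) (differentiable_mulVec _ hF)
    (hF.comp ((differentiable_const _).add differentiable_id))
    (fun z => by rw [herm_mulVec hA, h.norm_one]) (fun z => h.norm_one _)
    (fun z v => by rw [fderiv_mulVec _ (hF z), herm_mulVec hA, h.herm_fderiv])
    (fun z v => by rw [fderiv_comp_add_left, h.herm_fderiv])
    (fun z => by
      have h3 := hR t z
      obtain ⟨h1, e1⟩ := hl (t + z)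
      obtain ⟨h2, e2⟩ := hl z
      rw [e1, e2, su3Act, Projectivization.map_mk, Projectivization.mk_eq_mk_iff'] at h3
      obtain ⟨c, hc⟩ := h3
      exact ⟨c, hc.symm⟩)
  refine ⟨c • (A : Matrix _ _ ℂ), ?_, fun z => ?_⟩
  · rw [Matrix.conjTranspose_smul, Matrix.smul_mul, Matrix.mul_smul, hA, smul_smul,
      ← starRingEnd_apply, mul_comm, hc, one_smul]
  · rw [hcF, Matrix.smul_mulVec]

theorem IsTranslator.fderiv {t : ℝ} {S : Matrix (Fin 3) (Fin 3) ℂ} (hS : IsTranslator F t S)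
    (hF : Differentiable ℝ F) (z v : ℂ) : fderiv ℝ F (t + z) v = S *ᵥ fderiv ℝ F z v := by
  rw [← fderiv_comp_add_left, funext hS.2, fderiv_mulVec _ (hF z)]

theorem IsTranslator.wz {t : ℝ} {S : Matrix (Fin 3) (Fin 3) ℂ} (hS : IsTranslator F t S)
    (hF : Differentiable ℝ F) : IsTranslator (wz F) t S :=
  ⟨hS.1, fun z => by
    simp only [MinLag.wz, hS.fderiv hF, Matrix.mulVec_smul, Matrix.mulVec_sub]⟩

theorem IsTranslator.wzbar {t : ℝ} {S : Matrix (Fin 3) (Fin 3) ℂ} (hS : IsTranslator F t S)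
    (hF : Differentiable ℝ F) : IsTranslator (wzbar F) t S :=
  ⟨hS.1, fun z => by
    simp only [MinLag.wzbar, hS.fderiv hF, Matrix.mulVec_smul, Matrix.mulVec_add]⟩

theorem IsMinimalLift.metric_translate (h : IsMinimalLift F e Ψ)
    (hS : ∀ t : ℝ, ∃ S, IsTranslator F t S) (t : ℝ) (z : ℂ) : e (t + z) = e z := by
  obtain ⟨S, hS⟩ := hS t
  have h1 := h.metric (t + z)
  rw [(hS.wz h.differentiableAt).2, herm_mulVec hS.1, h.metric] at h1
  exact_mod_cast h1.symm

theorem IsMinimalLift.hopf_translate (h : IsMinimalLift F e Ψ)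
    (hS : ∀ t : ℝ, ∃ S, IsTranslator F t S) (t : ℝ) (z : ℂ) : Ψ (t + z) = Ψ z := by
  obtain ⟨S, hS⟩ := hS t
  rw [h.hopf, h.hopf, (hS.wzbar h.differentiableAt).2,
    ((hS.wz h.differentiableAt).wz h.differentiableAt_wz).2, herm_mulVec hS.1]

/-- Holomorphy together with vanishing x-derivative kills the y-derivative too. -/
theorem IsMinimalLift.hopf_const (h : IsMinimalLift F e Ψ)
    (hS : ∀ t : ℝ, ∃ S, IsTranslator F t S) (z : ℂ) : Ψ z = Ψ 0 := by
  have hd : Differentiable ℝ Ψ := h.contDiff_hopf.differentiable (by simp)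
  refine is_const_of_fderiv_eq_zero hd (fun z => ?_) z 0
  have h1 := fderiv_one_eq_zero hd (h.hopf_translate hS) z
  have h2 := h.wzbar_hopf z
  simp only [MinLag.wzbar, h1, zero_add, smul_eq_mul, mul_eq_zero, I_ne_zero, false_or] at h2
  ext1 v
  rw [fderiv_apply_eq, h1, h2.resolve_left (by norm_num)]
  simp

theorem IsMinimalLift.wz_metric (h : IsMinimalLift F e Ψ)
    (hS : ∀ t : ℝ, ∃ S, IsTranslator F t S) (z : ℂ) :
    MinLag.wz (fun z => (e z : ℂ)) z = -(I / 2) * (fderiv ℝ e z I : ℝ) := by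
  have hd := h.contDiff_metric.differentiable (by simp)
  simp only [MinLag.wz]
  rw [fderiv_ofReal_comp hd, fderiv_ofReal_comp hd,
    fderiv_one_eq_zero hd (h.metric_translate hS)]
  simp only [smul_eq_mul, ofReal_zero]
  ring

theorem IsMinimalLift.wzbar_metric (h : IsMinimalLift F e Ψ)
    (hS : ∀ t : ℝ, ∃ S, IsTranslator F t S) (z : ℂ) :
    MinLag.wzbar (fun z => (e z : ℂ)) z = (I / 2) * (fderiv ℝ e z I : ℝ) := by
  have hd := h.contDiff_metric.differentiable (by simp)
  simp only [MinLag.wzbar]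
  rw [fderiv_ofReal_comp hd, fderiv_ofReal_comp hd,
    fderiv_one_eq_zero hd (h.metric_translate hS)]
  simp only [smul_eq_mul, ofReal_zero]
  ring

/-- Without x-dependence the Wirtinger derivatives of `e` are ∓(i/2)e_y, and the Gauss equation
becomes an ordinary one in y. -/
theorem IsMinimalLift.gauss_translate (h : IsMinimalLift F e Ψ)
    (hS : ∀ t : ℝ, ∃ S, IsTranslator F t S) (z : ℂ) :
    e z * fderiv ℝ (fun z => fderiv ℝ e z I) z I
      = (fderiv ℝ e z I) ^ 2 - 4 * e z ^ 3 + 4 * ‖Ψ z‖ ^ 2 := by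
  have hd := h.contDiff_metric.differentiable (by simp)
  have hd2 : Differentiable ℝ fun z => fderiv ℝ e z I :=
    (h.contDiff_metric.fderiv_right (m := ∞) (by simp)).clm_apply contDiff_const
      |>.differentiable (by simp)
  have hx : fderiv ℝ (fun z => fderiv ℝ e z I) z 1 = 0 := by
    refine fderiv_one_eq_zero hd2 (fun t z => ?_) z
    rw [← fderiv_comp_add_left, funext (h.metric_translate hS t)]
  have h1 := h.gauss z
  have h2 : MinLag.wzbar (MinLag.wz fun z => (e z : ℂ)) z
      = (fderiv ℝ (fun z => fderiv ℝ e z I) z I : ℝ) / 4 := by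
    rw [funext (h.wz_metric hS)]
    simp only [MinLag.wzbar]
    have h3 : ∀ v, fderiv ℝ (fun z => -(I / 2) * ((fderiv ℝ e z I : ℝ) : ℂ)) z v
        = -(I / 2) * (fderiv ℝ (fun z => fderiv ℝ e z I) z v : ℝ) := by
      intro v
      have h5 : DifferentiableAt ℝ (fun z => ((fderiv ℝ e z I : ℝ) : ℂ)) z :=
        (Complex.ofRealCLM.differentiable.comp hd2) z
      rw [← fderiv_ofReal_comp hd2, fderiv_const_mul h5]
      rfl
    rw [h3, h3, hx]
    simp only [smul_eq_mul, ofReal_zero]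
    linear_combination (-1 / 4) * ((fderiv ℝ (fun z => fderiv ℝ e z I) z I : ℝ) : ℂ) * I_sq
  rw [h2, h.wz_metric hS, h.wzbar_metric hS, Complex.mul_conj'] at h1
  have h4 : ((e z * fderiv ℝ (fun z => fderiv ℝ e z I) z I : ℝ) : ℂ)
      = (((fderiv ℝ e z I) ^ 2 - 4 * e z ^ 3 + 4 * ‖Ψ z‖ ^ 2 : ℝ) : ℂ) := by
    push_cast
    linear_combination 4 * h1 - ((fderiv ℝ e z I : ℝ) : ℂ) ^ 2 * I_sq
  exact_mod_cast h4

end Lift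

/-- The first integral of the metric equation. -/
theorem first_integral {w w' w'' : ℝ → ℝ} {q β : ℝ} (hpos : ∀ y, 0 < w y)
    (hw : ∀ y, HasDerivAt w (w' y) y) (hw' : ∀ y, HasDerivAt w' (w'' y) y)
    (hg : ∀ y, w y * w'' y = w' y ^ 2 - 4 * w y ^ 3 + 4 * q)
    (h0 : w' 0 ^ 2 = 4 * β * w 0 ^ 2 - 8 * w 0 ^ 3 - 4 * q) (y : ℝ) :
    w' y ^ 2 = 4 * β * w y ^ 2 - 8 * w y ^ 3 - 4 * q := by
  -- This quotient is the conserved quantity; the initial condition says that its value is 4β.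
  have hd : ∀ y, HasDerivAt (fun y => (w' y ^ 2 + 8 * w y ^ 3 + 4 * q) / w y ^ 2) 0 y := by
    intro y
    have h1 := ((((hw' y).fun_pow 2).fun_add (((hw y).fun_pow 3).const_mul 8)).add_const
      (4 * q)).fun_div ((hw y).fun_pow 2) (pow_ne_zero 2 (hpos y).ne')
    refine h1.congr_deriv ?_
    have := (hpos y).ne'
    rw [div_eq_zero_iff]
    left
    simp only [Nat.cast_ofNat, Nat.add_one_sub_one, pow_one]
    linear_combination (2 * w' y * w y) * hg y
  have hc := is_const_of_deriv_eq_zero (fun y => (hd y).differentiableAt)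
    (fun y => (hd y).deriv) y 0
  have h1 := (hpos y).ne'
  have h2 := (hpos 0).ne'
  simp only [h0] at hc
  rw [show (4 * β * w 0 ^ 2 - 8 * w 0 ^ 3 - 4 * q + 8 * w 0 ^ 3 + 4 * q) / w 0 ^ 2 = 4 * β by
    field_simp; ring, div_eq_iff (pow_ne_zero 2 h1)] at hc
  linear_combination hc

/-! ### Modes: functionals diagonalising the real translations -/

theorem fderiv_clm_comp (L : (Fin 3 → ℂ) →L[ℂ] ℂ) {F : ℂ → Fin 3 → ℂ} {z : ℂ}
    (hF : DifferentiableAt ℝ F z) (v : ℂ) :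
    fderiv ℝ (fun z => L (F z)) z v = L (fderiv ℝ F z v) := by
  have h : HasFDerivAt (fun z => L (F z)) ((L.restrictScalars ℝ).comp (fderiv ℝ F z)) z :=
    (L.restrictScalars ℝ).hasFDerivAt.comp z hF.hasFDerivAt
  rw [h.fderiv]
  rfl

/-- The matrix, in the coordinates `(ℓ(F_z), ℓ(F_z̄), ℓ(F))` at the origin, of the transposed
infinitesimal translation acting on linear functionals `ℓ`. -/
noncomputable def dualPotential (a Ψ : ℂ) : Matrix (Fin 3) (Fin 3) ℂ :=
  !![0, Ψ / a, -a; -(starRingEnd ℂ) Ψ / a, 0, -a; 1, 1, 0]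

/-- The hypothesis is the characteristic equation of `dualPotential`, the same cubic as for
`potential` when Ψ = −iλ⁻³ψ. -/
theorem exists_dualPotential_eigenvector {a Ψ μ : ℂ} (ha : a ≠ 0)
    (hμ : μ ^ 3 + (2 * a + Ψ * (starRingEnd ℂ) Ψ / a ^ 2) * μ + Ψ - (starRingEnd ℂ) Ψ = 0) :
    ∃ p : Fin 3 → ℂ, p ≠ 0 ∧ dualPotential a Ψ *ᵥ p = μ • p := by
  have hdet : (dualPotential a Ψ - Matrix.scalar (Fin 3) μ).det = 0 := by
    simp [dualPotential, Matrix.det_fin_three]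
    rw [← sub_eq_zero] at hμ
    field_simp at hμ ⊢
    linear_combination -hμ
  obtain ⟨p, hp, h⟩ := Matrix.exists_mulVec_eq_zero_iff.2 hdet
  refine ⟨p, hp, ?_⟩
  rw [Matrix.sub_mulVec, sub_eq_zero] at h
  rw [h]
  ext i
  simp [Matrix.scalar_apply, Matrix.mulVec_diagonal]

section Modes

variable {F : ℂ → Fin 3 → ℂ} {e : ℂ → ℝ} {Ψ : ℂ → ℂ}

/-- The functional with prescribed values on the frame `F_z, F_z̄, F` at the origin. -/
noncomputable def frameFunctional (F : ℂ → Fin 3 → ℂ) (a : ℂ) (p : Fin 3 → ℂ) :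
    (Fin 3 → ℂ) →L[ℂ] ℂ :=
  LinearMap.toContinuousLinearMap
    { toFun := fun V => herm V (wz F 0) / a * p 0 + herm V (wzbar F 0) / a * p 1
        + herm V (F 0) * p 2
      map_add' := fun V W => by simp only [herm_add_left]; ring
      map_smul' := fun c V => by simp only [herm_smul_left, RingHom.id_apply, smul_eq_mul]; ring }

theorem frameFunctional_apply (a : ℂ) (p V : Fin 3 → ℂ) :
    frameFunctional F a p V = herm V (wz F 0) / a * p 0 + herm V (wzbar F 0) / a * p 1
      + herm V (F 0) * p 2 := rfl

/-- `ℓ ∘ F` is multiplied by a character under real translations, infinitesimally. -/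
def IsMode (F : ℂ → Fin 3 → ℂ) (d : ℝ) (L : (Fin 3 → ℂ) →L[ℂ] ℂ) : Prop :=
  ∀ z, L (fderiv ℝ F z 1) = I * d * L (F z)

/-- Expand F(z) in the frame at 0. The translator is linear and carries the frame along, so the
coefficients stay constant in t. Differentiating this identity at t = 0 requires no regularity of t
↦ S. -/
theorem IsMinimalLift.fderiv_one_eq_frame (h : IsMinimalLift F e Ψ)
    (hS : ∀ t : ℝ, ∃ S, IsTranslator F t S) (z : ℂ) :
    fderiv ℝ F z 1 = (herm (F z) (wz F 0) / e 0) • fderiv ℝ (wz F) 0 1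
      + (herm (F z) (wzbar F 0) / e 0) • fderiv ℝ (wzbar F) 0 1
      + herm (F z) (F 0) • fderiv ℝ F 0 1 := by
  have h1 : ∀ t : ℝ, F (t * 1 + z) = (herm (F z) (wz F 0) / e 0) • wz F (t * 1 + 0)
      + (herm (F z) (wzbar F 0) / e 0) • wzbar F (t * 1 + 0)
      + herm (F z) (F 0) • F (t * 1 + 0) := by
    intro t
    obtain ⟨S, hS⟩ := hS t
    rw [mul_one, hS.2, hS.2, (hS.wz h.differentiableAt).2, (hS.wzbar h.differentiableAt).2,
      ← Matrix.mulVec_smul, ← Matrix.mulVec_smul, ← Matrix.mulVec_smul, ← Matrix.mulVec_add,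
      ← Matrix.mulVec_add, ← h.expansion]
  have h2 := hasDerivAt_line (fun z => h.differentiableAt z) z 1 0
  have h3 := (((hasDerivAt_line h.differentiableAt_wz 0 1 0).const_smul
    (herm (F z) (wz F 0) / e 0)).fun_add
    ((hasDerivAt_line h.differentiableAt_wzbar 0 1 0).const_smul
    (herm (F z) (wzbar F 0) / e 0))).fun_add
    ((hasDerivAt_line h.differentiableAt 0 1 0).const_smul (herm (F z) (F 0)))
  rw [funext h1] at h2
  have := h2.unique h3
  simpa using this

theorem IsMinimalLift.frameFunctional_wz (h : IsMinimalLift F e Ψ) (p : Fin 3 → ℂ) :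
    frameFunctional F (e 0) p (wz F 0) = p 0 := by
  have ha : (e 0 : ℂ) ≠ 0 := ofReal_ne_zero.2 (h.pos 0).ne'
  rw [frameFunctional_apply, h.metric, h.conformal, h.horizontal]
  field_simp; simp

theorem IsMinimalLift.frameFunctional_wzbar (h : IsMinimalLift F e Ψ) (p : Fin 3 → ℂ) :
    frameFunctional F (e 0) p (wzbar F 0) = p 1 := by
  have ha : (e 0 : ℂ) ≠ 0 := ofReal_ne_zero.2 (h.pos 0).ne'
  rw [frameFunctional_apply, h.metric', h.conformal', h.horizontal']
  field_simp; simp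

theorem IsMinimalLift.frameFunctional_self (h : IsMinimalLift F e Ψ) (p : Fin 3 → ℂ) :
    frameFunctional F (e 0) p (F 0) = p 2 := by
  rw [frameFunctional_apply, h.norm_one, ← conj_herm, h.horizontal, ← conj_herm, h.horizontal']
  simp

/-- Since e_y(0) = 0, the x-derivatives of the frame at 0 have exactly the coefficients recorded in
`dualPotential`, and an eigenvector there is a mode everywhere by the frame expansion. -/
theorem IsMinimalLift.isMode_frameFunctional (h : IsMinimalLift F e Ψ)
    (hS : ∀ t : ℝ, ∃ S, IsTranslator F t S) (h0 : fderiv ℝ e 0 I = 0) {d : ℝ} {p : Fin 3 → ℂ}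
    (hp : dualPotential (e 0) (Ψ 0) *ᵥ p = (I * d) • p) :
    IsMode F d (frameFunctional F (e 0) p) := by
  intro z
  have p0 := congrFun hp 0
  have p1 := congrFun hp 1
  have p2 := congrFun hp 2
  simp [dualPotential, Matrix.mulVec, dotProduct, Fin.sum_univ_three] at p0 p1 p2
  rw [h.fderiv_one_eq_frame hS, fderiv_one_eq (wz F), fderiv_one_eq (wzbar F), fderiv_one_eq F,
    h.wz_wz, h.wzbar_wz, h.wz_wzbar, h.wzbar_wzbar, h.wz_metric hS, h.wzbar_metric hS, h0]
  simp only [map_add, map_smul, smul_eq_mul, h.frameFunctional_wz, h.frameFunctional_wzbar,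
    h.frameFunctional_self, frameFunctional_apply (V := F z), ofReal_zero]
  linear_combination (herm (F z) (wz F 0) / e 0) * p0 + (herm (F z) (wzbar F 0) / e 0) * p1
    + (herm (F z) (F 0)) * p2

theorem IsMode.apply_translate {d : ℝ} {L : (Fin 3 → ℂ) →L[ℂ] ℂ} (hL : IsMode F d L)
    (hF : Differentiable ℝ F) (x : ℝ) (z : ℂ) : L (F (x + z)) = exp (I * d * x) * L (F z) := by
  have h1 : ∀ x : ℝ, HasDerivAt (fun x : ℝ => exp (-(I * d * x)) * L (F (x * 1 + z))) 0 x := by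
    intro x
    have h2 : HasDerivAt (fun x : ℝ => L (F (x * 1 + z))) (L (fderiv ℝ F (x * 1 + z) 1)) x :=
      (L.restrictScalars ℝ).hasFDerivAt.comp_hasDerivAt x (hasDerivAt_line hF z 1 x)
    have h3 : HasDerivAt (fun x : ℝ => exp (-(I * d * x))) (exp (-(I * d * x)) * -(I * d)) x := by
      have := ((Complex.ofRealCLM.hasDerivAt (x := x)).const_mul (I * d)).fun_neg.cexp
      simpa using this
    refine (h3.mul h2).congr_deriv ?_
    rw [hL]
    ring
  have h2 := is_const_of_deriv_eq_zero (fun y => (h1 y).differentiableAt)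
    (fun y => (h1 y).deriv) x 0
  simp only [mul_one, ofReal_zero, mul_zero, neg_zero, Complex.exp_zero, zero_add, one_mul] at h2
  rw [← h2, ← mul_assoc, ← Complex.exp_add]
  simp

theorem IsMinimalLift.fderiv_fderiv_one (h : IsMinimalLift F e Ψ) (z : ℂ) :
    fderiv ℝ (fun z => fderiv ℝ F z 1) z 1 =
      wz (wz F) z + wzbar (wzbar F) z - (2 * (e z : ℂ)) • F z := by
  rw [funext (fderiv_one_eq F),
    fderiv_fun_add (h.differentiableAt_wz z) (h.differentiableAt_wzbar z)]
  simp only [_root_.add_apply]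
  rw [fderiv_one_eq (wz F), fderiv_one_eq (wzbar F), h.wzbar_wz, h.wz_wzbar]
  module

theorem IsMinimalLift.fderiv_fderiv_I (h : IsMinimalLift F e Ψ) (z : ℂ) :
    fderiv ℝ (fun z => fderiv ℝ F z I) z I =
      -(wz (wz F) z + wzbar (wzbar F) z + (2 * (e z : ℂ)) • F z) := by
  have hd : DifferentiableAt ℝ (fun z => wz F z - wzbar F z) z :=
    (h.differentiableAt_wz z).sub (h.differentiableAt_wzbar z)
  have : fderiv ℝ (fun z => I • (wz F z - wzbar F z)) z = I • _ :=
    (hd.hasFDerivAt.const_smul I).fderiv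
  rw [funext (fderiv_I_eq F), this, fderiv_fun_sub (h.differentiableAt_wz z)
    (h.differentiableAt_wzbar z)]
  simp only [_root_.smul_apply, _root_.sub_apply]
  rw [fderiv_I_eq (wz F), fderiv_I_eq (wzbar F), h.wzbar_wz, h.wz_wzbar, ← smul_sub, smul_smul,
    I_mul_I]
  module

theorem IsMode.fderiv_fderiv_one {d : ℝ} {L : (Fin 3 → ℂ) →L[ℂ] ℂ} (hL : IsMode F d L)
    (hF : ContDiff ℝ ∞ F) (z : ℂ) :
    L (fderiv ℝ (fun z => fderiv ℝ F z 1) z 1) = -d ^ 2 * L (F z) := by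
  have hd := hF.differentiable (by simp) z
  rw [← fderiv_clm_comp L ((contDiff_fderiv_apply hF 1).differentiable (by simp) z), funext hL,
    show (fun z => I * d * L (F z)) = fun z => ((I * d) • L) (F z) from rfl, fderiv_clm_comp _ hd]
  simp only [_root_.smul_apply, smul_eq_mul]
  rw [hL]
  linear_combination (d : ℂ) ^ 2 * L (F z) * I_sq

/-- The second order equation for a mode along the imaginary direction. -/
theorem IsMode.second_order {d : ℝ} {L : (Fin 3 → ℂ) →L[ℂ] ℂ} (hL : IsMode F d L)
    (h : IsMinimalLift F e Ψ) (z : ℂ) :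
    L (fderiv ℝ (fun z => fderiv ℝ F z I) z I) = ((d ^ 2 - 4 * e z : ℝ) : ℂ) * L (F z) := by
  have h1 := hL.fderiv_fderiv_one h.smooth z
  rw [h.fderiv_fderiv_one] at h1
  rw [h.fderiv_fderiv_I]
  simp only [map_add, map_sub, map_neg, map_smul, smul_eq_mul] at h1 ⊢
  push_cast
  -- F_xx + F_yy = 4F_{z z̄} = −4eF, while F_xx acts on the mode as −d².
  linear_combination -h1

/-- The first order equation for a mode along the imaginary direction. -/
theorem IsMode.first_order {d : ℝ} {L : (Fin 3 → ℂ) →L[ℂ] ℂ} (hL : IsMode F d L)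
    (h : IsMinimalLift F e Ψ) (hS : ∀ t : ℝ, ∃ S, IsTranslator F t S) (z : ℂ) :
    L (fderiv ℝ F z I) * (I * (Ψ z + (starRingEnd ℂ) (Ψ z)) - (fderiv ℝ e z I : ℝ)) =
      L (F z) * (4 * (e z : ℂ) ^ 2 - 2 * d ^ 2 * e z - I * d * (Ψ z - (starRingEnd ℂ) (Ψ z))) := by
  have he : (e z : ℂ) ≠ 0 := ofReal_ne_zero.2 (h.pos z).ne'
  have h1 := hL.fderiv_fderiv_one h.smooth z
  have hx := hL z
  rw [h.fderiv_fderiv_one, h.wz_wz, h.wzbar_wzbar, h.wz_metric hS, h.wzbar_metric hS] at h1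
  rw [fderiv_one_eq] at hx
  rw [fderiv_I_eq]
  simp only [map_add, map_sub, map_smul, smul_eq_mul] at h1 hx ⊢
  -- F_xx in the frame is a relation between ℓ(F_z) and ℓ(F_z̄). Their sum is known from the
  -- character and their difference is a multiple of ℓ(F_y), so the relation determines ℓ(F_y)
  -- wherever its coefficient is nonzero.
  have h2 : -(I / 2) * (fderiv ℝ e z I : ℝ) * L (wz F z) + Ψ z * L (wzbar F z)
      + (-(starRingEnd ℂ) (Ψ z) * L (wz F z) + I / 2 * (fderiv ℝ e z I : ℝ) * L (wzbar F z))
      - 2 * e z ^ 2 * L (F z) = -d ^ 2 * e z * L (F z) := by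
    have h3 := congrArg (fun x => x * (e z : ℂ)) h1
    field_simp at h3
    linear_combination h3 / 2
  linear_combination 2 * h2 - (Ψ z - (starRingEnd ℂ) (Ψ z)) * hx +
    (L (wz F z) - L (wzbar F z)) * (Ψ z + (starRingEnd ℂ) (Ψ z)) * I_sq

end Modes

/-! ### Closing of translations in terms of modes -/

section Separation

variable {F : ℂ → Fin 3 → ℂ} {e : ℂ → ℝ} {Ψ : ℂ → ℂ} {f : ℂ → CP2}

/-- Distinct eigenvalues give independent eigenvectors, so the three functionals form a basis of the
dual space. -/
theorem frameFunctional_separating (h : IsMinimalLift F e Ψ) {A : Matrix (Fin 3) (Fin 3) ℂ}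
    {μ : Fin 3 → ℂ} (hμ : Function.Injective μ) {p : Fin 3 → Fin 3 → ℂ} (hp0 : ∀ j, p j ≠ 0)
    (hp : ∀ j, A *ᵥ p j = μ j • p j) (V : Fin 3 → ℂ)
    (hV : ∀ j, frameFunctional F (e 0) (p j) V = 0) : V = 0 := by
  have hli : LinearIndependent ℂ (Matrix.row (Matrix.of p)) :=
    Module.End.eigenvectors_linearIndependent' (Matrix.mulVecLin A) μ hμ p fun j =>
      ⟨Module.End.mem_eigenspace_iff.2 (hp j), hp0 j⟩
  rw [Matrix.linearIndependent_rows_iff_isUnit] at hli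
  have h1 : Matrix.of p *ᵥ ![herm V (wz F 0) / e 0, herm V (wzbar F 0) / e 0, herm V (F 0)]
      = 0 := by
    ext j
    have := hV j
    rw [frameFunctional_apply] at this
    simp [Matrix.mulVec, dotProduct, Fin.sum_univ_three]
    linear_combination this
  have h2 := Matrix.mulVec_injective_of_isUnit hli (h1.trans (Matrix.mulVec_zero _).symm)
  have e0 := congrFun h2 0
  have e1 := congrFun h2 1
  have e2 := congrFun h2 2
  simp only [Matrix.cons_val, Pi.zero_apply] at e0 e1 e2
  rw [h.expansion 0 V, e0, e1, e2]
  simp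

/-- If a mode vanished on the imaginary axis, the character law would make it vanish along all of
`F`, hence on the frame F_z, F_z̄, F at 0, whose values are the entries of `p`. -/
theorem exists_mode_ne_zero (h : IsMinimalLift F e Ψ) {p : Fin 3 → ℂ} (hp : p ≠ 0) {d : ℝ}
    (hL : IsMode F d (frameFunctional F (e 0) p)) :
    ∃ y : ℝ, frameFunctional F (e 0) p (F (y * I)) ≠ 0 := by
  by_contra! hc
  set L := frameFunctional F (e 0) p
  have hz : ∀ z, L (F z) = 0 := by
    intro z
    rw [← re_add_im z, hL.apply_translate h.differentiableAt, hc, mul_zero]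
  have hd : ∀ v, L (fderiv ℝ F 0 v) = 0 := by
    intro v
    rw [← fderiv_clm_comp L (h.differentiableAt 0), funext hz]
    simp
  apply hp
  ext j
  fin_cases j
  · refine (h.frameFunctional_wz p).symm.trans (?_ : L _ = 0)
    simp [wz, hd]
  · refine (h.frameFunctional_wzbar p).symm.trans (?_ : L _ = 0)
    simp [wzbar, hd]
  · exact (h.frameFunctional_self p).symm.trans (hz 0)

/-- A translation closes up in `ℂP²` iff it acts on all modes by the same multiplier. -/
theorem translation_closes_iff (h : IsMinimalLift F e Ψ)
    (hl : ∀ z, ∃ h : F z ≠ 0, f z = Projectivization.mk ℂ (F z) h)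
    {L : Fin 3 → (Fin 3 → ℂ) →L[ℂ] ℂ} (hsep : ∀ V, (∀ j, L j V = 0) → V = 0)
    (hne : ∀ j, ∃ z, L j (F z) ≠ 0) {w : ℂ} {ν : Fin 3 → ℂ}
    (hν : ∀ j z, L j (F (z + w)) = ν j * L j (F z)) :
    (∀ z, f (z + w) = f z) ↔ ∀ j k, ν j = ν k := by
  constructor
  · intro hf
    obtain ⟨c, -, hc⟩ := horizontal_lift_unique (F := F) (H := fun z => F (z + w))
      h.differentiableAt (fun z => (h.differentiableAt _).comp z
        (differentiableAt_id.add (differentiableAt_const _)))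
      h.norm_one (fun z => h.norm_one _) h.herm_fderiv
      (fun z v => by rw [fderiv_comp_add_right, h.herm_fderiv])
      (fun z => exists_smul_of_eq hl (hf z))
    have : ∀ j, ν j = c := by
      intro j
      obtain ⟨z, hz⟩ := hne j
      have h1 := hν j z
      rw [hc, map_smul, smul_eq_mul] at h1
      exact (mul_right_cancel₀ hz h1).symm
    intro j k
    rw [this, this]
  · intro hj z
    have h1 : F (z + w) = ν 0 • F z := by
      rw [← sub_eq_zero]
      refine hsep _ fun j => ?_
      rw [map_sub, hν, map_smul, hj j 0, smul_eq_mul, sub_self]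
    obtain ⟨h2, e2⟩ := hl (z + w)
    obtain ⟨h3, e3⟩ := hl z
    rw [e2, e3, Projectivization.mk_eq_mk_iff']
    exact ⟨ν 0, h1.symm⟩

/-- A multiplier of a nonzero mode is unimodular, since the lift is bounded. -/
theorem norm_multiplier_eq_one (h : IsMinimalLift F e Ψ) {L : (Fin 3 → ℂ) →L[ℂ] ℂ} {w ν : ℂ}
    {z : ℂ} (hz : L (F z) ≠ 0) (hν : ∀ z, L (F (z + w)) = ν * L (F z)) : ‖ν‖ = 1 := by
  have hb : ∀ z, ‖L (F z)‖ ≤ ‖L‖ := fun z => by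
    refine (L.le_opNorm _).trans (mul_le_of_le_one_right (norm_nonneg _) ?_)
    exact (pi_norm_le_iff_of_nonneg zero_le_one).2 fun k => norm_apply_le_one (h.norm_one z) k
  have hpos : ∀ (n : ℕ), L (F (z + n * w)) = ν ^ n * L (F z) := by
    intro n
    induction n with
    | zero => simp
    | succ n ih => rw [Nat.cast_succ, add_mul, one_mul, ← add_assoc, hν, ih]; ring
  -- Backward translates are written without inverting ν, which is not yet known to be nonzero.
  have hneg : ∀ (n : ℕ), ν ^ n * L (F (z - n * w)) = L (F z) := by
    intro n
    induction n with
    | zero => simp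
    | succ n ih =>
      rw [← ih, Nat.cast_succ, show z - n * w = (z - (n + 1) * w) + w by ring, hν]; ring
  have hz' : 0 < ‖L (F z)‖ := norm_pos_iff.2 hz
  refine le_antisymm ?_ ?_
  · by_contra! hlt
    obtain ⟨n, hn⟩ := pow_unbounded_of_one_lt (‖L‖ / ‖L (F z)‖) hlt
    have := hb (z + n * w)
    rw [hpos, norm_mul, norm_pow, ← le_div_iff₀ hz'] at this
    linarith
  · by_contra! hlt
    have hδ : 0 < ‖L (F z)‖ / (‖L‖ + 1) := div_pos hz' (by positivity)
    obtain ⟨n, hn⟩ := ((tendsto_pow_atTop_nhds_zero_of_lt_one (norm_nonneg ν)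
      hlt).eventually_lt_const hδ).exists
    have h1 := congrArg norm (hneg n)
    rw [norm_mul, norm_pow] at h1
    rw [lt_div_iff₀ (by positivity)] at hn
    have h2 := mul_le_mul_of_nonneg_left (hb (z - n * w)) (pow_nonneg (norm_nonneg ν) n)
    nlinarith [pow_nonneg (norm_nonneg ν) n]

end Separation

/-! ### Arithmetic of phases and distinct eigenvalues -/

section Arithmetic

theorem exp_I_mul_eq_iff (x y : ℝ) :
    exp (I * x) = exp (I * y) ↔ ∃ n : ℤ, x - y = 2 * Real.pi * n := by
  rw [Complex.exp_eq_exp_iff_exists_int]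
  refine exists_congr fun n => ?_
  constructor
  · intro h
    have h1 : I * ((x - y : ℝ) : ℂ) = I * ((2 * Real.pi * n : ℝ) : ℂ) := by
      push_cast; linear_combination h
    exact_mod_cast mul_left_cancel₀ I_ne_zero h1
  · intro h
    have h1 : (x : ℂ) = y + 2 * Real.pi * n := by
      rw [← sub_eq_iff_eq_add']; exact_mod_cast h
    rw [h1]; ring

/-- The multipliers `exp(i m τ_j)` agree for some `m ≠ 0` iff the trace-free parts `θ_j` of the
phases `-τ_j` are rational multiples of `2π`. -/
theorem exists_common_multiplier_iff {θ τ : Fin 3 → ℝ} (hsum : θ 0 + θ 1 + θ 2 = 0)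
    (hθτ : ∀ j k, θ j + τ j = θ k + τ k) :
    (∃ m : ℤ, m ≠ 0 ∧ ∀ j k, exp (I * τ j) ^ m = exp (I * τ k) ^ m) ↔
      (∃ r : ℚ, θ 0 = 2 * Real.pi * r) ∧ ∃ r : ℚ, θ 1 = 2 * Real.pi * r := by
  have hexp : ∀ (m : ℤ) j, exp (I * τ j) ^ m = exp (I * ((m * τ j : ℝ) : ℂ)) := by
    intro m j
    rw [← Complex.exp_int_mul]
    congr 1; push_cast; ring
  simp only [hexp, exp_I_mul_eq_iff]
  constructor
  · rintro ⟨m, hm, h⟩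
    obtain ⟨a, ha⟩ := h 0 1
    obtain ⟨b, hb⟩ := h 0 2
    have hm' : (m : ℝ) ≠ 0 := by exact_mod_cast hm
    have h1 := hθτ 0 1
    have h2 := hθτ 0 2
    -- As the θ_j sum to 0, 3θ₀ = (θ₀ − θ₁) + (θ₀ − θ₂), and similarly for θ₁; the differences are
    -- those of −τ.
    refine ⟨⟨-(a + b) / (3 * m), ?_⟩, ⟨(2 * a - b) / (3 * m), ?_⟩⟩
    · push_cast
      field_simp
      linear_combination (-1) * ha - hb + m * h1 + m * h2 + m * hsum
    · push_cast
      field_simp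
      linear_combination (2) * ha - hb - 2 * m * h1 + m * h2 + m * hsum
  · rintro ⟨⟨r, hr⟩, ⟨s, hs⟩⟩
    have h2 : θ 2 = 2 * Real.pi * (-r - s : ℚ) := by push_cast; linear_combination hsum - hr - hs
    obtain ⟨ρ, hρ⟩ : ∃ ρ : Fin 3 → ℚ, ∀ j, θ j = 2 * Real.pi * ρ j :=
      ⟨![r, s, -r - s], fun j => by fin_cases j <;> simp [hr, hs, h2]⟩
    -- The product of the denominators makes every θ_j an integral multiple of 2π, hence all
    -- differences of the τ_j as well.
    refine ⟨∏ j, (ρ j).den, ?_, fun j k => ?_⟩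
    · exact_mod_cast Finset.prod_ne_zero_iff.2 fun j _ => (ρ j).den_nz
    · have hint : ∀ j, ∃ n : ℤ, ((∏ j, (ρ j).den : ℕ) : ℚ) * ρ j = n := by
        intro j
        obtain ⟨c, hc⟩ := Finset.dvd_prod_of_mem (fun j => (ρ j).den) (Finset.mem_univ j)
        refine ⟨c * (ρ j).num, ?_⟩
        rw [hc]
        push_cast
        rw [mul_assoc, mul_comm (c : ℚ), ← mul_assoc, Rat.den_mul_eq_num, mul_comm]
      obtain ⟨a, ha⟩ := hint j
      obtain ⟨b, hb⟩ := hint k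
      refine ⟨b - a, ?_⟩
      have ha' : ((∏ j, (ρ j).den : ℕ) : ℝ) * ρ j = a := by exact_mod_cast ha
      have hb' : ((∏ j, (ρ j).den : ℕ) : ℝ) * ρ k = b := by exact_mod_cast hb
      have h3 := hθτ j k
      rw [hρ, hρ] at h3
      push_cast at ha' hb' ⊢
      linear_combination (∏ j, ((ρ j).den : ℝ)) * h3 + 2 * Real.pi * hb' - 2 * Real.pi * ha'

/-- The zero sum forces a common multiplier to be a cube root of unity, so each 3d_j p lies in 2πℤ.
-/
theorem exists_real_period_iff {d : Fin 3 → ℝ} (hsum : d 0 + d 1 + d 2 = 0) (h1 : d 1 ≠ 0) :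
    (∃ p : ℝ, p ≠ 0 ∧ ∀ j k, exp (I * d j * p) = exp (I * d k * p)) ↔ ∃ q : ℚ, d 0 / d 1 = q := by
  have hexp : ∀ (p : ℝ) j, exp (I * d j * p) = exp (I * ((d j * p : ℝ) : ℂ)) := by
    intro p j
    congr 1; push_cast; ring
  simp only [hexp, exp_I_mul_eq_iff]
  constructor
  · rintro ⟨p, hp, h⟩
    obtain ⟨a, ha⟩ := h 0 1
    obtain ⟨b, hb⟩ := h 0 2
    have e0 : 3 * (d 0 * p) = 2 * Real.pi * (a + b) := by linear_combination ha + hb + p * hsum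
    have e1 : 3 * (d 1 * p) = 2 * Real.pi * (b - 2 * a) := by
      linear_combination -2 * ha + hb + p * hsum
    have hne : ((b : ℝ) - 2 * a) ≠ 0 := by
      intro h0
      rw [h0, mul_zero] at e1
      have : d 1 * p = 0 := by linarith
      exact mul_ne_zero h1 hp this
    refine ⟨(a + b) / (b - 2 * a), ?_⟩
    push_cast
    rw [div_eq_div_iff h1 hne]
    have h2 : (3 * p * (2 * Real.pi)) ≠ 0 := by
      have := Real.pi_pos.ne'
      positivity
    apply mul_left_cancel₀ h2
    linear_combination (2 * Real.pi * (b - 2 * a)) * e0 - (2 * Real.pi * (a + b)) * e1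
  · rintro ⟨q, hq⟩
    have hq' : d 0 = q * d 1 := by rw [← hq]; field_simp
    have hden : ((q.den : ℚ) * q : ℚ) = q.num := Rat.den_mul_eq_num q
    have hden' : (q.den : ℝ) * q = q.num := by exact_mod_cast hden
    -- This period makes all three multipliers equal to 1.
    obtain ⟨N, hN⟩ : ∃ N : Fin 3 → ℤ, ∀ j,
        d j * (2 * Real.pi * q.den / d 1) = 2 * Real.pi * N j := by
      refine ⟨![q.num, q.den, -q.num - q.den], fun j => ?_⟩
      have h2 : d 2 = -(q + 1) * d 1 := by linear_combination hsum - hq'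
      fin_cases j
      · simp [hq', ← hden']; field_simp
      · simp; field_simp
      · simp [h2, ← hden']; field_simp; ring
    refine ⟨2 * Real.pi * q.den / d 1, ?_, fun j k => ⟨N j - N k, ?_⟩⟩
    · have : (q.den : ℝ) ≠ 0 := by exact_mod_cast q.den_nz
      have := Real.pi_pos.ne'
      positivity
    · rw [hN, hN]; push_cast; ring

/-- A repeated root d₁ would give β = 3d₁² and Q = d₁³, hence β³ = 27Q². -/
theorem ne_of_discriminant {d₁ d₂ d₃ β Q q : ℝ} (h1 : d₁ + d₂ + d₃ = 0)
    (h2 : d₁ * d₂ + d₁ * d₃ + d₂ * d₃ = -β) (h3 : d₁ * d₂ * d₃ = -(2 * Q)) (hQ : Q ^ 2 ≤ q)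
    (hβ : 27 * q < β ^ 3) : d₁ ≠ d₂ := by
  rintro rfl
  have e3 : d₃ = -2 * d₁ := by linarith
  subst e3
  have e1 : β = 3 * d₁ ^ 2 := by linarith
  have e2 : Q = d₁ ^ 3 := by linarith
  rw [e1] at hβ
  rw [e2] at hQ
  nlinarith

end Arithmetic

/-! ### Floquet multipliers -/

section FirstOrder

/-- Floquet multiplier of a periodic nonsingular first order equation `D g' = q g`. -/
theorem periodic_first_order_multiplier {g g' D q : ℝ → ℂ} {P : ℝ}
    (hg : ∀ y, HasDerivAt g (g' y) y) (heq : ∀ y, g' y * D y = g y * q y) (hD0 : ∀ y, D y ≠ 0)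
    (hD : Continuous D) (hq : Continuous q) (hDP : Function.Periodic D P)
    (hqP : Function.Periodic q P) (y : ℝ) :
    g (y + P) = exp (∫ s in (0 : ℝ)..P, q s / D s) * g y := by
  have hc : Continuous fun s => q s / D s := hq.div hD hD0
  have hper : Function.Periodic (fun s => q s / D s) P := fun s => by simp only [hDP s, hqP s]
  have hint : ∀ a b, IntervalIntegrable (fun s => q s / D s) volume a b :=
    fun a b => hc.intervalIntegrable a b
  have h1 : ∀ y, HasDerivAt (fun y => exp (-∫ s in (0 : ℝ)..y, q s / D s) * g y) 0 y := by
    intro y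
    have h2 : HasDerivAt (fun y => ∫ s in (0 : ℝ)..y, q s / D s) (q y / D y) y :=
      (hc.integral_hasStrictDerivAt 0 y).hasDerivAt
    refine (h2.fun_neg.cexp.mul (hg y)).congr_deriv ?_
    have h3 : g' y = g y * (q y / D y) := by
      rw [mul_div_assoc', eq_div_iff (hD0 y), heq]
    rw [h3]; ring
  have h2 := is_const_of_deriv_eq_zero (fun y => (h1 y).differentiableAt) (fun y => (h1 y).deriv)
  have h3 : ∀ y, g y = exp (∫ s in (0 : ℝ)..y, q s / D s) * g 0 := by
    intro y
    have := h2 y 0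
    simp only [intervalIntegral.integral_same, neg_zero, Complex.exp_zero, one_mul] at this
    rw [← this, ← mul_assoc, ← Complex.exp_add]
    simp
  have h4 := hper.intervalIntegral_add_eq y 0
  rw [zero_add] at h4
  rw [h3 (y + P), h3 y, ← mul_assoc, ← Complex.exp_add,
    ← intervalIntegral.integral_add_adjacent_intervals (hint 0 y) (hint y (y + P)), h4, add_comm]

theorem proportional_of_linear_second_order {c : ℝ → ℝ} {C : ℝ} (hc : ∀ y, |c y| ≤ C)
    {g g' k k' : ℝ → ℂ} (hg : ∀ y, HasDerivAt g (g' y) y)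
    (hg' : ∀ y, HasDerivAt g' (c y * g y) y) (hk : ∀ y, HasDerivAt k (k' y) y)
    (hk' : ∀ y, HasDerivAt k' (c y * k y) y) {y₀ : ℝ} {ρ : ℂ} (h0 : g y₀ ≠ 0)
    (hgρ : g' y₀ = ρ * g y₀) (hkρ : k' y₀ = ρ * k y₀) (y : ℝ) : k y = k y₀ / g y₀ * g y := by
  have := eq_zero_of_linear_second_order hc (g := fun y => k y - k y₀ / g y₀ * g y)
    (g' := fun y => k' y - k y₀ / g y₀ * g' y) (y₀ := y₀)
    (fun y => (hk y).sub ((hg y).const_mul _))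
    (fun y => ((hk' y).sub ((hg' y).const_mul _)).congr_deriv (by ring))
    (by field_simp; ring) (by simp only [hgρ, hkρ]; field_simp; ring) y
  exact sub_eq_zero.1 this

/-- A nonzero solution of `g'' = c g` which also satisfies a real singular first order equation
has a real Floquet multiplier. -/
theorem exists_real_multiplier {c D q : ℝ → ℝ} {C P : ℝ} (hc : ∀ y, |c y| ≤ C)
    (hcP : Function.Periodic c P) (hDP : Function.Periodic D P) (hqP : Function.Periodic q P)
    {g g' : ℝ → ℂ} (hg : ∀ y, HasDerivAt g (g' y) y) (hg' : ∀ y, HasDerivAt g' (c y * g y) y)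
    (heq : ∀ y, g' y * D y = g y * q y) {y₀ : ℝ} (hD : D y₀ ≠ 0) (hne : ∃ y, g y ≠ 0) :
    ∃ μ : ℝ, ∀ y, g (y + P) = μ * g y := by
  have hDc : (D y₀ : ℂ) ≠ 0 := ofReal_ne_zero.2 hD
  have hρ : ∀ a b : ℂ, a * D y₀ = b * q y₀ → a = ((q y₀ / D y₀ : ℝ) : ℂ) * b := by
    intro a b h
    push_cast
    rw [div_mul_eq_mul_div, eq_div_iff hDc, h, mul_comm]
  have hgρ := hρ _ _ (heq y₀)
  have h0 : g y₀ ≠ 0 := by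
    intro h0
    obtain ⟨y, hy⟩ := hne
    rw [h0, mul_zero] at hgρ
    exact hy (eq_zero_of_linear_second_order hc hg hg' h0 hgρ y)
  -- The first order equation at y₀ fixes the logarithmic derivative there. Both the translate by P
  -- and the conjugate of g share it, hence are multiples of g.
  have hshift := proportional_of_linear_second_order hc hg hg' (k := fun y => g (y + P))
    (k' := fun y => g' (y + P)) (fun y => (hg (y + P)).comp_add_const y P)
    (fun y => ((hg' (y + P)).comp_add_const y P).congr_deriv (by rw [hcP y])) h0 hgρ
    (hρ _ _ (by have := heq (y₀ + P); rwa [hDP, hqP] at this))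
  have hconj := proportional_of_linear_second_order hc hg hg'
    (k := fun y => (starRingEnd ℂ) (g y)) (k' := fun y => (starRingEnd ℂ) (g' y))
    (fun y => Complex.conjCLE.hasFDerivAt.comp_hasDerivAt y (hg y))
    (fun y => (Complex.conjCLE.hasFDerivAt.comp_hasDerivAt y (hg' y)).congr_deriv (by simp))
    h0 hgρ (hρ _ _ (by
      have := congrArg (starRingEnd ℂ) (heq y₀)
      simpa using this))
  have hreal : (starRingEnd ℂ) (g (y₀ + P) / g y₀) = g (y₀ + P) / g y₀ := by
    have h1 := hconj (y₀ + P)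
    have h2 : (starRingEnd ℂ) (g y₀) ≠ 0 := (_root_.map_ne_zero _).2 h0
    rw [map_div₀, h1]
    field_simp
  obtain ⟨μ, hμ⟩ := Complex.conj_eq_iff_real.1 hreal
  exact ⟨μ, fun y => by rw [← hμ]; exact hshift y⟩

end FirstOrder

/-! ### Principal values by reflection -/

section PrincipalValue

/-- The truncated set is invariant under s ↦ P − s, which changes the sign of the integrand. -/
theorem setIntegral_eq_zero_of_odd {k den : ℝ → ℂ} {P ε : ℝ} (hε : 0 < ε) (hcont : Continuous den)
    (h0 : den 0 = 0)
    (hden : ∀ s, den (P - s) = -den s) (hk : ∀ s, k (P - s) = -k s) :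
    ∫ s in {s : ℝ | s ∈ Set.Ioc 0 P ∧ ε < ‖den s‖}, k s = 0 := by
  set A : Set ℝ := {s : ℝ | s ∈ Set.Ioc 0 P ∧ ε < ‖den s‖}
  have hAm : MeasurableSet A :=
    measurableSet_Ioc.inter (measurableSet_lt measurable_const hcont.norm.measurable)
  have hP : den P = 0 := by rw [← sub_zero P, hden, h0, neg_zero]
  have hsymm : ∀ s, s ∈ A → P - s ∈ A := by
    rintro s ⟨⟨h1, h2⟩, h3⟩
    -- The interval is half-open and P would reflect to the excluded point 0; but the truncation
    -- already removes P, since `den` vanishes there.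
    have h4 : s ≠ P := fun h => by
      rw [h, hP, norm_zero] at h3
      exact hε.not_gt h3
    refine ⟨⟨sub_pos.2 (lt_of_le_of_ne h2 h4), by linarith⟩, ?_⟩
    rw [hden, norm_neg]
    exact h3
  have hind : ∀ s, A.indicator k (P - s) = -A.indicator k s := by
    intro s
    by_cases hs : s ∈ A
    · rw [Set.indicator_of_mem hs, Set.indicator_of_mem (hsymm s hs), hk]
    · have : P - s ∉ A := fun h => hs (by simpa using hsymm _ h)
      rw [Set.indicator_of_notMem hs, Set.indicator_of_notMem this, neg_zero]
  have h1 := integral_sub_left_eq_self (A.indicator k) volume P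
  simp only [hind, integral_neg] at h1
  rw [← integral_indicator hAm]
  exact self_eq_neg.1 h1.symm

theorem hasPrincipalValue_zero_of_odd {k den : ℝ → ℂ} {P : ℝ} (hcont : Continuous den)
    (h0 : den 0 = 0)
    (hden : ∀ s, den (P - s) = -den s) (hk : ∀ s, k (P - s) = -k s) :
    HasPrincipalValue k den P 0 := by
  refine tendsto_const_nhds.congr' ?_
  filter_upwards [self_mem_nhdsWithin] with ε hε
  exact (setIntegral_eq_zero_of_odd hε hcont h0 hden hk).symm

/-- The principal value of an odd function with simple denominator plus a constant. -/
theorem exists_hasPrincipalValue_const_add_odd {k den : ℝ → ℂ} {P : ℝ} (c b : ℂ)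
    (hcont : Continuous den) (h0 : den 0 = 0) (hden : ∀ s, den (P - s) = -den s)
    (hk : ∀ s, den s ≠ 0 → k s = c + b / den s) :
    ∃ V : ℝ, HasPrincipalValue k den P (V * c) := by
  set A : ℝ → Set ℝ := fun ε => {s : ℝ | s ∈ Set.Ioc 0 P ∧ ε < ‖den s‖} with hA
  have hAm : ∀ ε, MeasurableSet (A ε) := fun ε =>
    measurableSet_Ioc.inter (measurableSet_lt measurable_const hcont.norm.measurable)
  have hAfin : ∀ ε, volume (A ε) < ⊤ := fun ε =>
    (measure_mono fun s hs => hs.1).trans_lt measure_Ioc_lt_top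
  have hanti : Antitone fun ε => volume.real (A ε) := fun ε ε' h =>
    measureReal_mono (fun s hs => ⟨hs.1, h.trans_lt hs.2⟩) (hAfin _).ne
  -- V is the limit of the measures of the truncated sets, which grow as ε decreases and stay inside
  -- (0, P].
  refine ⟨_, (((Complex.continuous_ofReal.tendsto _).comp
    (hanti.tendsto_nhdsGT 0)).mul_const c).congr' ?_⟩
  filter_upwards [self_mem_nhdsWithin] with ε hε
  have hε' : 0 < ε := hε
  have h1 : ∫ s in A ε, k s = ∫ s in A ε, (c + b / den s) := by
    refine setIntegral_congr_fun (hAm ε) fun s hs => hk s fun h => ?_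
    have := hs.2
    rw [h, norm_zero] at this
    exact hε'.not_gt this
  have h2 : IntegrableOn (fun s => b / den s) (A ε) := by
    refine Measure.integrableOn_of_bounded (M := ‖b‖ / ε) (hAfin ε).ne
      (measurable_const.div hcont.measurable).aestronglyMeasurable ?_
    refine (ae_restrict_iff' (hAm ε)).2 (Eventually.of_forall fun s hs => ?_)
    rw [norm_div]
    exact div_le_div_of_nonneg_left (norm_nonneg _) hε' hs.2.le
  have h3 : ∫ s in A ε, b / den s = 0 :=
    setIntegral_eq_zero_of_odd hε' hcont h0 hden fun s => by rw [hden, div_neg]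
  simp only [Function.comp]
  have h4 : IntegrableOn (fun _ => c) (A ε) := integrableOn_const (hAfin ε).ne
  rw [h1, integral_add h4 h2, h3, add_zero, setIntegral_const]
  simp

end PrincipalValue

/-! ### The constants a₂, a₃, β and the spectrum of D(λ₀) -/

section Constants

variable {a : ℝ} {ψ : ℂ}

/-- a₂ and −a₃ are the roots of x² − hx − ah with h = |ψ|²/(2a²); the relations are their sum and
product, so h = a₂ − a₃. -/
theorem aTwo_aThree_spec (ha : 0 < a) (hψ : ψ ≠ 0) :
    0 < aTwo a ψ ∧ 0 < aThree a ψ ∧ betaConst a ψ = 2 * (a + aTwo a ψ - aThree a ψ) ∧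
      a * aTwo a ψ = (a + aTwo a ψ) * aThree a ψ ∧
      ‖ψ‖ ^ 2 = 2 * a ^ 2 * (aTwo a ψ - aThree a ψ) := by
  have hh : betaConst a ψ / 2 - a = ‖ψ‖ ^ 2 / (2 * a ^ 2) := by
    unfold betaConst; field_simp; ring
  have hpos : 0 < betaConst a ψ / 2 - a := by
    rw [hh]
    have := norm_pos_iff.2 hψ
    positivity
  have hβ : betaConst a ψ = 2 * (a + (betaConst a ψ / 2 - a)) := by ring
  have hn : ‖ψ‖ ^ 2 = 2 * a ^ 2 * (betaConst a ψ / 2 - a) := by rw [hh]; field_simp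
  unfold aTwo aThree
  set h := betaConst a ψ / 2 - a
  have hsq := Real.sq_sqrt (show 0 ≤ h ^ 2 + 4 * a * h by positivity)
  have hlt : h < √(h ^ 2 + 4 * a * h) := by
    apply Real.lt_sqrt_of_sq_lt
    have : 0 < 4 * a * h := by positivity
    linarith
  set R := √(h ^ 2 + 4 * a * h)
  refine ⟨by linarith, by linarith, by linarith, ?_, ?_⟩
  · linear_combination -hsq / 4
  · linear_combination hn

/-- With a₂ < a, the quadratic x² − hx − ah is positive at x = a, where its value is a(a − 2h). -/
theorem two_mul_lt_of_aTwo_lt (ha : 0 < a) (hψ : ψ ≠ 0) (h12 : aTwo a ψ < a) :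
    2 * (aTwo a ψ - aThree a ψ) < a := by
  obtain ⟨h2, h3, -, hrel, -⟩ := aTwo_aThree_spec ha hψ
  nlinarith

/-- With h = a₂ − a₃, β³ − 27|ψ|² = 2(a − 2h)²(4a + h). -/
theorem betaConst_cube_gt (ha : 0 < a) (hψ : ψ ≠ 0) (h12 : aTwo a ψ < a) :
    27 * ‖ψ‖ ^ 2 < betaConst a ψ ^ 3 := by
  have hlt := two_mul_lt_of_aTwo_lt ha hψ h12
  obtain ⟨h2, h3, hβ, hrel, hn⟩ := aTwo_aThree_spec ha hψ
  have hh : 0 < aTwo a ψ - aThree a ψ := by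
    have : 0 < ‖ψ‖ ^ 2 := by have := norm_pos_iff.2 hψ; positivity
    rw [hn] at this
    exact pos_of_mul_pos_right this (by positivity)
  rw [hn, hβ]
  set h := aTwo a ψ - aThree a ψ with hdef
  have e : 2 * (a + aTwo a ψ - aThree a ψ) = 2 * (a + h) := by rw [hdef]; ring
  rw [e]
  have h4 : 0 < (a - 2 * h) ^ 2 * (4 * a + h) := by
    have : 0 < a - 2 * h := by linarith
    positivity
  linarith

theorem halfPeriod_pos (ha : 0 < a) (hψ : ψ ≠ 0) (h12 : aTwo a ψ < a) : 0 < halfPeriod a ψ := by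
  obtain ⟨h2, h3, -, -, -⟩ := aTwo_aThree_spec ha hψ
  have hs : 0 < a + aThree a ψ := by linarith
  refine div_pos (ellipticJ_pos (div_nonneg (by linarith) hs.le) ?_ (by positivity))
    (Real.sqrt_pos.2 (by linarith))
  rw [div_lt_one hs]; linarith

theorem conj_zpow_neg_three_mul (lam : Circle) (ψ : ℂ) :
    (starRingEnd ℂ) ((lam : ℂ) ^ (-3 : ℤ) * ψ) = (lam : ℂ) ^ 3 * (starRingEnd ℂ) ψ := by
  rw [map_mul, map_zpow₀, ← Circle.coe_inv_eq_conj, Circle.coe_inv]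
  simp [zpow_neg]

/-- The characteristic polynomial of D(λ) is μ³ + βμ − 2i Re(λ⁻³ψ); these are Vieta's formulas for
it. -/
theorem eigenvalue_relations (ha : 0 < a) (lam : Circle) {d₁ d₂ d₃ : ℝ}
    (hd : (potential a ψ lam).charpoly =
      (X - C (I * (d₁ : ℂ))) * (X - C (I * (d₂ : ℂ))) * (X - C (I * (d₃ : ℂ)))) :
    d₁ + d₂ + d₃ = 0 ∧ d₁ * d₂ + d₁ * d₃ + d₂ * d₃ = -betaConst a ψ ∧
      d₁ * d₂ * d₃ = -(2 * ((lam : ℂ) ^ (-3 : ℤ) * ψ).re) := by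
  have hl : (lam : ℂ) ≠ 0 := Circle.coe_ne_zero lam
  have hac : (a : ℂ) ≠ 0 := ofReal_ne_zero.2 ha.ne'
  have hs : (√a : ℂ) ^ 2 = a := by exact_mod_cast Real.sq_sqrt ha.le
  have hconj := conj_zpow_neg_three_mul lam ψ
  have hre := Complex.add_conj ((lam : ℂ) ^ (-3 : ℤ) * ψ)
  rw [hconj] at hre
  have hn := Complex.mul_conj' ψ
  have key : ∀ μ : ℂ, μ ^ 3 + betaConst a ψ * μ - I * (2 * ((lam : ℂ) ^ (-3 : ℤ) * ψ).re : ℝ)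
      = (μ - I * d₁) * (μ - I * d₂) * (μ - I * d₃) := by
    intro μ
    have h1 := congrArg (Polynomial.eval μ) hd
    rw [Matrix.eval_charpoly] at h1
    simp only [Polynomial.eval_mul, Polynomial.eval_sub, Polynomial.eval_X, Polynomial.eval_C] at h1
    rw [← h1, ← hre]
    have hz : (lam : ℂ) ^ (-3 : ℤ) = (lam : ℂ)⁻¹ ^ 3 := by
      rw [zpow_neg, inv_pow]; norm_cast
    have hβ : (betaConst a ψ : ℂ) = 2 * a + ψ * (starRingEnd ℂ) ψ / a ^ 2 := by
      rw [hn, betaConst]; push_cast; rfl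
    rw [hβ, hz]
    simp only [potential, Matrix.det_fin_three]
    simp
    field_simp
    ring_nf
    rw [hs, I_sq, Complex.I_pow_three]
    ring
  -- The values at 0, 1 and −1 isolate the three coefficients.
  have k0 := key 0
  have k1 := key 1
  have k2 := key (-1)
  have hI : I ^ 3 = -I := Complex.I_pow_three
  refine ⟨?_, ?_, ?_⟩
  · have : I * ((d₁ + d₂ + d₃ : ℝ) : ℂ) = I * 0 := by
      push_cast
      linear_combination (1 / 2) * k1 + (1 / 2) * k2 - k0
    exact_mod_cast mul_left_cancel₀ I_ne_zero this
  · have : ((d₁ * d₂ + d₁ * d₃ + d₂ * d₃ : ℝ) : ℂ) = ((-betaConst a ψ : ℝ) : ℂ) := by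
      push_cast
      linear_combination (1 / 2) * k1 - (1 / 2) * k2 + (d₁ * d₂ + d₁ * d₃ + d₂ * d₃ : ℂ) * I_sq
    exact_mod_cast this
  · have : I * ((d₁ * d₂ * d₃ : ℝ) : ℂ) = I * ((-(2 * ((lam : ℂ) ^ (-3 : ℤ) * ψ).re) : ℝ) : ℂ) := by
      push_cast at k0 ⊢
      linear_combination (d₁ * d₂ * d₃ : ℂ) * hI - k0
    exact_mod_cast mul_left_cancel₀ I_ne_zero this

end Constants

/-! ### The metric factor along the imaginary axis -/

/-- The metric factor `w = e^v` along the imaginary axis, with its derivative `w'`, for a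
nonflat translationally equivariant surface of period `P`. -/
structure IsMetricProfile (β P : ℝ) (w w' : ℝ → ℝ) : Prop where
  pos : ∀ y, 0 < w y
  hasDerivAt : ∀ y, HasDerivAt w (w' y) y
  hasDerivAt' : ∀ y, HasDerivAt w' (4 * β * w y - 12 * w y ^ 2) y
  bdd : ∀ y, |w y| ≤ β / 2
  periodic : Function.Periodic w P
  deriv_zero : w' 0 = 0
  exists_deriv_ne_zero : ∃ y, w' y ≠ 0

namespace IsMetricProfile

variable {β P : ℝ} {w w' : ℝ → ℝ}

theorem continuous (h : IsMetricProfile β P w w') : Continuous w :=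
  continuous_iff_continuousAt.2 fun y => (h.hasDerivAt y).continuousAt

theorem continuous_deriv (h : IsMetricProfile β P w w') : Continuous w' :=
  continuous_iff_continuousAt.2 fun y => (h.hasDerivAt' y).continuousAt

theorem periodic_deriv (h : IsMetricProfile β P w w') : Function.Periodic w' P := by
  intro y
  have h1 := (h.hasDerivAt (y + P)).comp_add_const y P
  rw [funext h.periodic] at h1
  exact h1.unique (h.hasDerivAt y)

/-- Reflection at 0 preserves the equation and the initial data, since w'(0) = 0. -/
theorem even (h : IsMetricProfile β P w w') (y : ℝ) : w (-y) = w y := by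
  refine metric_ode_unique (β := β) (w := fun y => w (-y)) (w' := fun y => -w' (-y)) (fun y => ?_)
    (fun y => ?_) h.hasDerivAt h.hasDerivAt' (fun y => h.bdd _) h.bdd (by simp)
    (by simp [h.deriv_zero]) y
  · have := (h.hasDerivAt (-y)).scomp y (hasDerivAt_neg y)
    exact this.congr_deriv (by simp)
  · have := ((h.hasDerivAt' (-y)).scomp y (hasDerivAt_neg y)).neg
    exact this.congr_deriv (by simp)

theorem odd_deriv (h : IsMetricProfile β P w w') (y : ℝ) : w' (-y) = -w' y := by
  have h1 := (h.hasDerivAt (-y)).scomp y (hasDerivAt_neg y)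
  rw [show w ∘ Neg.neg = w from funext h.even] at h1
  have := h1.unique (h.hasDerivAt y)
  rw [← this]; simp

theorem reflect (h : IsMetricProfile β P w w') (y : ℝ) : w (P - y) = w y := by
  rw [sub_eq_neg_add, h.periodic, h.even]

theorem reflect_deriv (h : IsMetricProfile β P w w') (y : ℝ) : w' (P - y) = -w' y := by
  rw [sub_eq_neg_add, h.periodic_deriv, h.odd_deriv]

end IsMetricProfile

theorem IsMinimalLift.isMetricProfile {F : ℂ → Fin 3 → ℂ} {e : ℂ → ℝ} {Ψ : ℂ → ℂ}
    (h : IsMinimalLift F e Ψ) (hS : ∀ t : ℝ, ∃ S, IsTranslator F t S) {ψ : ℂ} (hψ : ψ ≠ 0)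
    (hnorm : ‖Ψ 0‖ = ‖ψ‖) (h0 : fderiv ℝ e 0 I = 0) (h12 : aTwo (e 0) ψ < e 0) :
    IsMetricProfile (betaConst (e 0) ψ) (2 * halfPeriod (e 0) ψ) (fun y => e (y * I))
      (fun y => fderiv ℝ e (y * I) I) := by
  have ha := h.pos 0
  obtain ⟨h2, h3, hβ, hrel, hn⟩ := aTwo_aThree_spec ha hψ
  have hlt := two_mul_lt_of_aTwo_lt ha hψ h12
  set β := betaConst (e 0) ψ with hβdef
  have hd := h.contDiff_metric.differentiable (by simp)
  have hw := hasDerivAt_imag hd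
  have hw' := hasDerivAt_imag (((h.contDiff_metric.fderiv_right (m := ∞) (by simp)).clm_apply
    (contDiff_const (c := I))).differentiable (by simp))
  have hg : ∀ y : ℝ, e (y * I) * fderiv ℝ (fun z => fderiv ℝ e z I) (y * I) I
      = fderiv ℝ e (y * I) I ^ 2 - 4 * e (y * I) ^ 3 + 4 * ‖ψ‖ ^ 2 := fun y => by
    rw [h.gauss_translate hS, h.hopf_const hS, hnorm]
  have hfirst := first_integral (β := β) (fun y => h.pos _) hw hw' hg (by
    simp only [ofReal_zero, zero_mul, h0, hβdef, betaConst]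
    field_simp
    ring)
  -- By the first integral, 4w²(β − 2w) = w'² + 4|ψ|² ≥ 0.
  have hbound : ∀ y : ℝ, e (y * I) ≤ β / 2 := by
    intro y
    have h4 := hfirst y
    have h5 := h.pos (y * I)
    have h6 : 0 ≤ 4 * e (y * I) ^ 2 * (β - 2 * e (y * I)) := by
      nlinarith [sq_nonneg (fderiv ℝ e (y * I) I), sq_nonneg ‖ψ‖]
    have := nonneg_of_mul_nonneg_right h6 (by positivity)
    linarith
  have hbdd : ∀ y : ℝ, |e (y * I)| ≤ β / 2 := fun y => by
    rw [abs_of_pos (h.pos _)]; exact hbound y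
  have hw'' : ∀ y : ℝ, HasDerivAt (fun y : ℝ => fderiv ℝ e (y * I) I)
      (4 * β * e (y * I) - 12 * e (y * I) ^ 2) y := by
    intro y
    refine (hw' y).congr_deriv ?_
    apply mul_left_cancel₀ (h.pos (y * I)).ne'
    rw [hg, hfirst]; ring
  have h00 : e ((0 : ℝ) * I) = e 0 := by simp
  have h00' : fderiv ℝ e ((0 : ℝ) * I) I = 0 := by simpa using h0
  refine ⟨fun y => h.pos _, hw, hw'', hbdd, fun y => ?_, h00', ?_⟩
  · exact periodic_of_metric_ode h2 h3 h12 hβ hrel hw hw'' hbdd h00 h00' y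
  · by_contra! hc
    -- A constant w would need w''(0) = 4a₁(2(a₂ − a₃) − a₁) to vanish, but this is negative.
    have h5 := hw'' 0
    rw [funext hc, h00] at h5
    have h6 := h5.unique (hasDerivAt_const _ _)
    have h7 : 4 * β * e 0 - 12 * e 0 ^ 2 =
        4 * e 0 * (2 * (aTwo (e 0) ψ - aThree (e 0) ψ) - e 0) := by
      rw [hβ]; ring
    rw [h7] at h6
    have : 4 * e 0 * (2 * (aTwo (e 0) ψ - aThree (e 0) ψ) - e 0) < 0 :=
      mul_neg_of_pos_of_neg (by linarith) (by linarith)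
    linarith

/-! ### Multipliers of imaginary translations -/

section Multipliers

variable {F : ℂ → Fin 3 → ℂ} {e : ℂ → ℝ} {Ψ : ℂ → ℂ} {d : ℝ} {L : (Fin 3 → ℂ) →L[ℂ] ℂ}

theorem IsMode.multiplier (hL : IsMode F d L) (hF : Differentiable ℝ F) {P : ℝ} {M : ℂ}
    (hM : ∀ y : ℝ, L (F ((y + P : ℝ) * I)) = M * L (F (y * I))) (z : ℂ) :
    L (F (z + P * I)) = M * L (F z) := by
  rw [← re_add_im z, add_assoc, ← add_mul, ← ofReal_add, hL.apply_translate hF,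
    hL.apply_translate hF, hM]
  ring

theorem int_multiplier {G : ℂ → ℂ} {w M : ℂ} (hM0 : M ≠ 0) (hM : ∀ z, G (z + w) = M * G z)
    (m : ℤ) (z : ℂ) : G (z + m * w) = M ^ m * G z := by
  have hneg : ∀ z, G (z - w) = M⁻¹ * G z := fun z => by
    have := hM (z - w)
    rw [sub_add_cancel] at this
    rw [this]; field_simp
  induction m using Int.induction_on with
  | zero => simp
  | succ n ih =>
    rw [zpow_add_one₀ hM0, mul_assoc, mul_comm M, ← mul_comm M, mul_left_comm, ← ih, ← hM]
    congr 1; push_cast; ring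
  | pred n ih =>
    rw [zpow_sub_one₀ hM0, mul_assoc, mul_left_comm, ← ih, ← hneg]
    congr 1; push_cast; ring

/-- The coefficient of the first order equation of a mode. -/
noncomputable def modeCoeff (w : ℝ → ℝ) (R d : ℝ) (y : ℝ) : ℝ :=
  4 * w y ^ 2 - 2 * d ^ 2 * w y - 2 * d * R

theorem continuous_modeCoeff {w : ℝ → ℝ} (hw : Continuous w) (R d : ℝ) :
    Continuous (modeCoeff w R d) := by
  unfold modeCoeff
  fun_prop

/-- For Ψ = −ip one has Ψ + Ψ̄ = 2 Im p and Ψ − Ψ̄ = −2i Re p; the equation is singular exactly when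
Im p = 0, at the zeros of e_y. -/
theorem IsMode.first_order_imag (hL : IsMode F d L) (h : IsMinimalLift F e Ψ)
    (hS : ∀ t : ℝ, ∃ S, IsTranslator F t S) {p : ℂ} (hΨ : ∀ z, Ψ z = -I * p) (y : ℝ) :
    L (fderiv ℝ F (y * I) I) * (2 * I * p.im - (fderiv ℝ e (y * I) I : ℝ)) =
      L (F (y * I)) * modeCoeff (fun y => e (y * I)) p.re d y := by
  have h1 := hL.first_order h hS (y * I)
  have h2 : I * (Ψ (y * I) + (starRingEnd ℂ) (Ψ (y * I))) = 2 * I * p.im := by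
    rw [hΨ, Complex.add_conj]
    simp; ring
  have h3 : I * d * (Ψ (y * I) - (starRingEnd ℂ) (Ψ (y * I))) = 2 * d * p.re := by
    rw [hΨ, Complex.sub_conj]
    simp
    linear_combination -(2 * d * p.re) * I_sq
  rw [h2, h3] at h1
  rw [h1, modeCoeff]
  push_cast
  rfl

end Multipliers

/-! ### Phases of the multipliers and the integrals β₁, β₂ -/

section Phase

theorem phase_denominator_ne_zero {S : ℝ} (hS : S ≠ 0) (x : ℝ) : (-2 * I * S - x : ℂ) ≠ 0 := by
  intro h
  have := congrArg Complex.im h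
  simp at this
  exact hS this

theorem continuous_inv_phase_denominator {w' : ℝ → ℝ} (hw' : Continuous w') {S : ℝ} (hS : S ≠ 0) :
    Continuous fun s => (1 / (-2 * I * S - w' s) : ℂ) :=
  continuous_const.div (by fun_prop) fun s => phase_denominator_ne_zero hS (w' s)

theorem conj_phase_denominator (S x : ℝ) :
    (starRingEnd ℂ) (-2 * I * S - x : ℂ) = 2 * I * S - x := by
  apply Complex.ext <;> simp

theorem phase_denominator_ne_zero' {S : ℝ} (hS : S ≠ 0) (x : ℝ) : (2 * I * S - x : ℂ) ≠ 0 := by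
  rw [← conj_phase_denominator]
  exact (_root_.map_ne_zero _).2 (phase_denominator_ne_zero hS x)

variable {w w' : ℝ → ℝ}

/-- The mode coefficient is real and 2iS − w' is the conjugate of −2iS − w', so the phase is a
combination of moments of n = Im(1/(−2iS − w')). The moments with d-dependent coefficients, those of
1 and w, are the ones occurring in Re β₁ and Im β₂. -/
theorem im_integral_modeCoeff (hw : Continuous w) (hw' : Continuous w') {S : ℝ}
    (hS : S ≠ 0) (R d P : ℝ) :
    (∫ s in (0 : ℝ)..P, (modeCoeff w R d s : ℂ) / (2 * I * S - w' s)).im =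
      -4 * (∫ s in (0 : ℝ)..P, w s ^ 2 * (1 / (-2 * I * S - w' s) : ℂ).im)
      + 2 * d ^ 2 * (∫ s in (0 : ℝ)..P, w s * (1 / (-2 * I * S - w' s) : ℂ).im)
      + 2 * d * R * ∫ s in (0 : ℝ)..P, (1 / (-2 * I * S - w' s) : ℂ).im := by
  have hn : Continuous fun s => (1 / (-2 * I * S - w' s) : ℂ).im :=
    Complex.continuous_im.comp (continuous_inv_phase_denominator hw' hS)
  have hc : Continuous fun s => (modeCoeff w R d s : ℂ) / (2 * I * S - w' s) := by
    exact Continuous.div (Complex.continuous_ofReal.comp (continuous_modeCoeff hw _ _))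
      (by fun_prop) fun s => phase_denominator_ne_zero' hS (w' s)
  have him : ∀ s, ((modeCoeff w R d s : ℂ) / (2 * I * S - w' s)).im =
      -4 * (w s ^ 2 * (1 / (-2 * I * S - w' s) : ℂ).im)
      + 2 * d ^ 2 * (w s * (1 / (-2 * I * S - w' s) : ℂ).im)
      + 2 * d * R * (1 / (-2 * I * S - w' s) : ℂ).im := by
    intro s
    have h1 : (modeCoeff w R d s : ℂ) / (2 * I * S - w' s) =
        modeCoeff w R d s * (starRingEnd ℂ) (1 / (-2 * I * S - w' s) : ℂ) := by
      rw [map_div₀, map_one, conj_phase_denominator]; ring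
    rw [h1, Complex.im_ofReal_mul, Complex.conj_im, modeCoeff]
    ring
  have h1 := Complex.imCLM.intervalIntegral_comp_comm (hc.intervalIntegrable (μ := volume) 0 P)
  simp only [Complex.imCLM_apply] at h1
  rw [← h1, intervalIntegral.integral_congr fun s _ => him s,
    intervalIntegral.integral_add, intervalIntegral.integral_add,
    intervalIntegral.integral_const_mul, intervalIntegral.integral_const_mul,
    intervalIntegral.integral_const_mul]
  all_goals exact Continuous.intervalIntegrable (by fun_prop) _ _

theorem re_integral_betaOne (hw' : Continuous w') {S : ℝ} (hS : S ≠ 0) (R P : ℝ) :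
    (∫ s in (0 : ℝ)..P, (2 * I * (R - I * S) - I * w' s) / (-2 * I * S - w' s) : ℂ).re =
      -2 * R * ∫ s in (0 : ℝ)..P, (1 / (-2 * I * S - w' s) : ℂ).im := by
  have hc : Continuous fun s => ((2 * I * (R - I * S) - I * w' s) / (-2 * I * S - w' s) : ℂ) :=
    Continuous.div (by fun_prop) (by fun_prop) fun s => phase_denominator_ne_zero hS (w' s)
  have hre : ∀ s, ((2 * I * (R - I * S) - I * w' s) / (-2 * I * S - w' s) : ℂ).re =
      -2 * R * (1 / (-2 * I * S - w' s) : ℂ).im := by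
    intro s
    have hne := phase_denominator_ne_zero hS (w' s)
    -- Up to the term 2iR, the numerator is i times the denominator.
    have h1 : ((2 * I * (R - I * S) - I * w' s) / (-2 * I * S - w' s) : ℂ) =
        I + ((2 * R : ℝ) : ℂ) * (I * (1 / (-2 * I * S - w' s))) := by
      have h0 := inv_mul_cancel₀ hne
      rw [one_div, div_eq_iff hne]
      push_cast
      linear_combination (-2 * R * I) * h0
    rw [h1, Complex.add_re, Complex.re_ofReal_mul, Complex.I_mul_re, Complex.I_re]
    ring
  have h1 := Complex.reCLM.intervalIntegral_comp_comm (hc.intervalIntegrable (μ := volume) 0 P)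
  simp only [Complex.reCLM_apply] at h1
  rw [← h1, intervalIntegral.integral_congr fun s _ => hre s, intervalIntegral.integral_const_mul]

theorem im_integral_betaTwo (hw : Continuous w) (hw' : Continuous w') {S : ℝ} (hS : S ≠ 0)
    (P : ℝ) :
    (∫ s in (0 : ℝ)..P, ((2 * w s : ℝ) : ℂ) / (-2 * I * S - w' s)).im =
      2 * ∫ s in (0 : ℝ)..P, w s * (1 / (-2 * I * S - w' s) : ℂ).im := by
  have hc : Continuous fun s => (((2 * w s : ℝ) : ℂ) / (-2 * I * S - w' s)) :=
    Continuous.div (by fun_prop) (by fun_prop) fun s => phase_denominator_ne_zero hS (w' s)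
  have him : ∀ s, (((2 * w s : ℝ) : ℂ) / (-2 * I * S - w' s)).im =
      2 * (w s * (1 / (-2 * I * S - w' s) : ℂ).im) := by
    intro s
    rw [← mul_one_div, Complex.im_ofReal_mul, mul_assoc]
  have h1 := Complex.imCLM.intervalIntegral_comp_comm (hc.intervalIntegrable (μ := volume) 0 P)
  simp only [Complex.imCLM_apply] at h1
  rw [← h1, intervalIntegral.integral_congr fun s _ => him s, intervalIntegral.integral_const_mul]

end Phase

/-! ### The integrands in terms of p = λ⁻³ψ and w' -/

section Integrands

theorem pow_three_mul_conj (lam : Circle) (ψ : ℂ) :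
    (lam : ℂ) ^ 3 * (starRingEnd ℂ) ψ = ((lam : ℂ) ^ (-3 : ℤ) * ψ).re -
      I * ((lam : ℂ) ^ (-3 : ℤ) * ψ).im := by
  rw [← conj_zpow_neg_three_mul]
  generalize (lam : ℂ) ^ (-3 : ℤ) * ψ = p
  apply Complex.ext <;> simp

theorem norm_zpow_neg_three_mul (lam : Circle) (ψ : ℂ) : ‖(lam : ℂ) ^ (-3 : ℤ) * ψ‖ = ‖ψ‖ := by
  rw [norm_mul, norm_zpow, Circle.norm_coe, one_zpow, one_mul]

variable {v w w' : ℝ → ℝ}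

theorem betaDen_eq (hw' : ∀ s, Real.exp (v s) * deriv v s = w' s) (lam : Circle) (ψ : ℂ) (s : ℝ) :
    betaDen v ψ lam s = -2 * I * ((lam : ℂ) ^ (-3 : ℤ) * ψ).im - w' s := by
  rw [betaDen, pow_three_mul_conj, hw']
  have := Complex.re_add_im ((lam : ℂ) ^ (-3 : ℤ) * ψ)
  linear_combination this

theorem betaOneIntegrand_eq (hw' : ∀ s, Real.exp (v s) * deriv v s = w' s) (lam : Circle) (ψ : ℂ)
    (s : ℝ) : betaOneIntegrand v ψ lam s =
      (2 * I * (((lam : ℂ) ^ (-3 : ℤ) * ψ).re - I * ((lam : ℂ) ^ (-3 : ℤ) * ψ).im) - I * w' s) /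
        (-2 * I * ((lam : ℂ) ^ (-3 : ℤ) * ψ).im - w' s) := by
  rw [betaOneIntegrand, betaDen_eq hw', mul_comm (deriv v s), hw', mul_assoc (2 * I),
    pow_three_mul_conj]

theorem betaTwoIntegrand_eq (hw : ∀ s, Real.exp (v s) = w s)
    (hw' : ∀ s, Real.exp (v s) * deriv v s = w' s) (lam : Circle) (ψ : ℂ)
    (s : ℝ) : betaTwoIntegrand v ψ lam s =
      ((2 * w s : ℝ) : ℂ) / (-2 * I * ((lam : ℂ) ^ (-3 : ℤ) * ψ).im - w' s) := by
  rw [betaTwoIntegrand, betaDen_eq hw', hw]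

end Integrands

/-! ### Mode bases and their multipliers -/

section Assembly

variable {F : ℂ → Fin 3 → ℂ} {e : ℂ → ℝ} {Ψ : ℂ → ℂ} {f : ℂ → CP2}

/-- A basis of modes. -/
structure IsModeBasis (F : ℂ → Fin 3 → ℂ) (d : Fin 3 → ℝ) (L : Fin 3 → (Fin 3 → ℂ) →L[ℂ] ℂ) :
    Prop where
  isMode : ∀ j, IsMode F (d j) (L j)
  separating : ∀ V, (∀ j, L j V = 0) → V = 0
  ne_zero : ∀ j, ∃ y : ℝ, L j (F (y * I)) ≠ 0

theorem IsMinimalLift.exists_modeBasis (h : IsMinimalLift F e Ψ)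
    (hS : ∀ t : ℝ, ∃ S, IsTranslator F t S) (h0 : fderiv ℝ e 0 I = 0) {ψ p : ℂ}
    (hp : ‖p‖ = ‖ψ‖) (hΨ : Ψ 0 = -I * p) {d : Fin 3 → ℝ} (hd : Function.Injective d)
    (h1 : d 0 + d 1 + d 2 = 0) (h2 : d 0 * d 1 + d 0 * d 2 + d 1 * d 2 = -betaConst (e 0) ψ)
    (h3 : d 0 * d 1 * d 2 = -(2 * p.re)) : ∃ L, IsModeBasis F d L := by
  have ha : (e 0 : ℂ) ≠ 0 := ofReal_ne_zero.2 (h.pos 0).ne'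
  have hroot : ∀ j, (I * d j) ^ 3 + (2 * e 0 + Ψ 0 * (starRingEnd ℂ) (Ψ 0) / (e 0 : ℂ) ^ 2) *
      (I * d j) + Ψ 0 - (starRingEnd ℂ) (Ψ 0) = 0 := by
    intro j
    have e1 : (2 * e 0 + Ψ 0 * (starRingEnd ℂ) (Ψ 0) / (e 0 : ℂ) ^ 2) = betaConst (e 0) ψ := by
      rw [Complex.mul_conj', hΨ, norm_mul, norm_neg, Complex.norm_I, one_mul, hp, betaConst]
      push_cast; rfl
    have e2 : Ψ 0 - (starRingEnd ℂ) (Ψ 0) = -I * (2 * p.re : ℝ) := by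
      rw [hΨ, Complex.sub_conj]
      simp; ring
    have e3 : d j ^ 3 - betaConst (e 0) ψ * d j + 2 * p.re = 0 := by
      have : (d j - d 0) * (d j - d 1) * (d j - d 2) = 0 := by fin_cases j <;> simp
      linear_combination this + d j ^ 2 * h1 - d j * h2 + h3
    have e3' : (d j : ℂ) ^ 3 - betaConst (e 0) ψ * d j + 2 * p.re = 0 := by exact_mod_cast e3
    rw [e1, add_sub_assoc, e2, mul_pow, Complex.I_pow_three]
    push_cast
    linear_combination -I * e3'
  choose p hp0 hpe using fun j => exists_dualPotential_eigenvector ha (hroot j)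
  have hmode : ∀ j, IsMode F (d j) (frameFunctional F (e 0) (p j)) :=
    fun j => h.isMode_frameFunctional hS h0 (hpe j)
  refine ⟨fun j => frameFunctional F (e 0) (p j), hmode, ?_, fun j =>
    exists_mode_ne_zero h (hp0 j) (hmode j)⟩
  refine frameFunctional_separating h (μ := fun j => I * d j) (fun j k hjk => hd ?_) hp0 hpe
  exact ofReal_injective (mul_left_cancel₀ I_ne_zero hjk)

variable {d : Fin 3 → ℝ} {L : Fin 3 → (Fin 3 → ℂ) →L[ℂ] ℂ}

theorem IsModeBasis.exists_real_cylinder_iff (hL : IsModeBasis F d L) (h : IsMinimalLift F e Ψ)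
    (hl : ∀ z, ∃ h : F z ≠ 0, f z = Projectivization.mk ℂ (F z) h) (hsum : d 0 + d 1 + d 2 = 0)
    (h1 : d 1 ≠ 0) : (∃ p : ℝ, IsCylinderRel f p) ↔ ∃ q : ℚ, d 0 / d 1 = q := by
  rw [← exists_real_period_iff hsum h1]
  refine exists_congr fun p => ?_
  rw [IsCylinderRel, ofReal_ne_zero, translation_closes_iff h hl hL.separating
    (fun j => let ⟨y, hy⟩ := hL.ne_zero j; ⟨_, hy⟩) (ν := fun j => exp (I * d j * p))
    fun j z => by rw [add_comm]; exact (hL.isMode j).apply_translate h.differentiableAt p z]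

theorem IsModeBasis.exists_imag_cylinder_iff (hL : IsModeBasis F d L) (h : IsMinimalLift F e Ψ)
    (hl : ∀ z, ∃ h : F z ≠ 0, f z = Projectivization.mk ℂ (F z) h) {T : ℝ} (hT : T ≠ 0)
    {M : Fin 3 → ℂ} (hM0 : ∀ j, M j ≠ 0)
    (hM : ∀ j (y : ℝ), L j (F ((y + 2 * T : ℝ) * I)) = M j * L j (F (y * I))) :
    (∃ m : ℤ, IsCylinderRel f (m * (2 * T) * I)) ↔ ∃ m : ℤ, m ≠ 0 ∧ ∀ j k, M j ^ m = M k ^ m := by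
  refine exists_congr fun m => ?_
  have hTc : (T : ℂ) ≠ 0 := ofReal_ne_zero.2 hT
  have hne : (m * (2 * T) * I : ℂ) ≠ 0 ↔ m ≠ 0 := by simp [hTc]
  rw [IsCylinderRel, hne, translation_closes_iff h hl hL.separating
    (fun j => let ⟨y, hy⟩ := hL.ne_zero j; ⟨_, hy⟩) (ν := fun j => M j ^ m) fun j z => ?_]
  have := int_multiplier (G := fun z => L j (F z)) (hM0 j)
    ((hL.isMode j).multiplier h.differentiableAt (hM j)) m z
  rw [← this]
  congr 3
  push_cast; ring

theorem IsMode.hasDerivAt_imag {d : ℝ} {L : (Fin 3 → ℂ) →L[ℂ] ℂ} (hL : IsMode F d L)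
    (h : IsMinimalLift F e Ψ) (y : ℝ) :
    HasDerivAt (fun y : ℝ => L (F (y * I))) (L (fderiv ℝ F (y * I) I)) y ∧
      HasDerivAt (fun y : ℝ => L (fderiv ℝ F (y * I) I))
        (((d ^ 2 - 4 * e (y * I) : ℝ) : ℂ) * L (F (y * I))) y := by
  constructor
  · exact (L.restrictScalars ℝ).hasFDerivAt.comp_hasDerivAt y
      (MinLag.hasDerivAt_imag h.differentiableAt y)
  · rw [← hL.second_order h]
    exact (L.restrictScalars ℝ).hasFDerivAt.comp_hasDerivAt y (MinLag.hasDerivAt_imag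
      ((contDiff_fderiv_apply h.smooth I).differentiable (by simp)) y)

/-- In the nonsingular case the multipliers are `exp(i τ_j)` with `τ_j` given by integrals. -/
theorem IsModeBasis.multiplier_nonreal (hL : IsModeBasis F d L) (h : IsMinimalLift F e Ψ)
    (hS : ∀ t : ℝ, ∃ S, IsTranslator F t S) {p : ℂ} (hΨ : ∀ z, Ψ z = -I * p) (hp : p.im ≠ 0)
    {β P : ℝ} (hw : IsMetricProfile β P (fun y => e (y * I)) (fun y => fderiv ℝ e (y * I) I))
    (j : Fin 3) (y : ℝ) :
    L j (F ((y + P : ℝ) * I)) =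
      exp (I * ((∫ s in (0 : ℝ)..P, (modeCoeff (fun y => e (y * I)) p.re (d j) s : ℂ) /
        (2 * I * p.im - (fderiv ℝ e (s * I) I : ℝ))).im : ℝ)) * L j (F (y * I)) := by
  have hc1 := hw.continuous
  have hc2 := hw.continuous_deriv
  have hg := periodic_first_order_multiplier (g := fun y : ℝ => L j (F (y * I)))
    (D := fun s => 2 * I * p.im - (fderiv ℝ e (s * I) I : ℝ))
    (q := fun s => (modeCoeff (fun y => e (y * I)) p.re (d j) s : ℂ)) (P := P)
    (fun y => ((hL.isMode j).hasDerivAt_imag h y).1)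
    (fun y => (hL.isMode j).first_order_imag h hS hΨ y)
    (fun y => phase_denominator_ne_zero' hp _) (by fun_prop)
    (Complex.continuous_ofReal.comp (continuous_modeCoeff hc1 _ _))
    (fun y => by simp only [hw.periodic_deriv y])
    (fun y => by simp only [modeCoeff, hw.periodic y])
  set Θ := ∫ s in (0 : ℝ)..P, (modeCoeff (fun y => e (y * I)) p.re (d j) s : ℂ) /
        (2 * I * p.im - (fderiv ℝ e (s * I) I : ℝ))
  obtain ⟨y₀, hy₀⟩ := hL.ne_zero j
  -- Boundedness of the lift gives Re Θ = 0 without evaluating the integral of the real part.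
  have hnorm := norm_multiplier_eq_one h hy₀ ((hL.isMode j).multiplier h.differentiableAt hg)
  rw [Complex.norm_exp, Real.exp_eq_one_iff] at hnorm
  have : Θ = I * (Θ.im : ℝ) := by
    apply Complex.ext <;> simp [hnorm]
  rw [← this]
  exact hg y

/-- In the singular case the multipliers are `±1`. -/
theorem IsModeBasis.multiplier_real (hL : IsModeBasis F d L) (h : IsMinimalLift F e Ψ)
    (hS : ∀ t : ℝ, ∃ S, IsTranslator F t S) {p : ℂ} (hΨ : ∀ z, Ψ z = -I * p) (hp : p.im = 0)
    {β P : ℝ} (hw : IsMetricProfile β P (fun y => e (y * I)) (fun y => fderiv ℝ e (y * I) I))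
    (j : Fin 3) :
    ∃ μ : ℂ, μ ^ 2 = 1 ∧ ∀ y : ℝ, L j (F ((y + P : ℝ) * I)) = μ * L j (F (y * I)) := by
  -- Non-flatness supplies a point where the singular equation determines the logarithmic
  -- derivative.
  obtain ⟨y₁, hy₁⟩ := hw.exists_deriv_ne_zero
  obtain ⟨μ, hμ⟩ := exists_real_multiplier (g := fun y : ℝ => L j (F (y * I)))
    (c := fun y => d j ^ 2 - 4 * e (y * I)) (D := fun y => -fderiv ℝ e (y * I) I)
    (q := modeCoeff (fun y => e (y * I)) p.re (d j)) (P := P) (C := |d j ^ 2| + 4 * (β / 2))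
    (fun y => (abs_sub _ _).trans (by
      rw [abs_mul 4, abs_of_pos (by norm_num : (0 : ℝ) < 4)]; linarith [hw.bdd y]))
    (fun y => by simp only [hw.periodic y]) (fun y => by simp only [hw.periodic_deriv y])
    (fun y => by simp only [modeCoeff, hw.periodic y])
    (fun y => ((hL.isMode j).hasDerivAt_imag h y).1)
    (fun y => ((hL.isMode j).hasDerivAt_imag h y).2)
    (fun y => by
      have := (hL.isMode j).first_order_imag h hS hΨ y
      rw [hp] at this
      simpa using this) (neg_ne_zero.2 hy₁) (hL.ne_zero j)
  obtain ⟨y₀, hy₀⟩ := hL.ne_zero j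
  have hnorm := norm_multiplier_eq_one h hy₀ ((hL.isMode j).multiplier h.differentiableAt hμ)
  refine ⟨μ, ?_, hμ⟩
  rw [Complex.norm_real, Real.norm_eq_abs] at hnorm
  rw [← ofReal_pow, ← sq_abs, hnorm]; simp

end Assembly

theorem IsAssociatedMember.exists_minimalLift {lam : Circle} {u : ℂ → ℝ} {ψ : ℂ → ℂ} {f : ℂ → CP2}
    (hf : IsAssociatedMember lam u ψ f) :
    ∃ F : ℂ → Fin 3 → ℂ, IsMinimalLift F (fun z => Real.exp (u z))
        (fun z => -I * ((lam : ℂ) ^ (-3 : ℤ) * ψ z)) ∧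
      ∀ z, ∃ h : F z ≠ 0, f z = Projectivization.mk ℂ (F z) h := by
  obtain ⟨F, hF, h1, h2, h3, h4, h5⟩ := hf
  refine ⟨F, ⟨hF.smooth, hF.norm_one, hF.horizontal, hF.horizontal', fun z => Real.exp_pos _,
    h1, h2, h3, h4, fun z => ?_⟩, hF.lifts⟩
  rw [← mul_assoc]
  exact h5 z

end MinLag

/-! ### The main theorem -/

open MinLag in
theorem mainTheorem12
    (lam0 : Circle) (u : ℂ → ℝ) (ψ : ℂ → ℂ) (f : ℂ → MinLag.CP2)
    -- `f = f(·, lam0)` is a member of an associated family, and translationally equivariant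
    (hf : MinLag.IsAssociatedMember lam0 u ψ f)
    (hequiv : MinLag.IsTranslationallyEquivariant f)
    -- the cubic differential is not identically zero
    (hψ : ∃ z, ψ z ≠ 0)
    -- normalization of the origin, `∂u/∂y (0) = 0` and `a₂ < a₁`; the surface is not flat
    (hu0 : fderiv ℝ u 0 I = 0)
    (ha : MinLag.aTwo (Real.exp (u 0)) (ψ 0) < Real.exp (u 0))
    -- `i d₁, i d₂, i d₃` are the eigenvalues of `D(lam0)`
    (d₁ d₂ d₃ : ℝ)
    (hd : (MinLag.potential (Real.exp (u 0)) (ψ 0) lam0).charpoly =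
      (X - C (I * (d₁ : ℂ))) * (X - C (I * (d₂ : ℂ))) * (X - C (I * (d₃ : ℂ))))
    -- `T`, `β`, and `u` as a function of `y`
    (T β : ℝ) (v : ℝ → ℝ)
    (hT : T = MinLag.halfPeriod (Real.exp (u 0)) (ψ 0))
    (hβ : β = MinLag.betaConst (Real.exp (u 0)) (ψ 0))
    (hv : v = fun y : ℝ => u (y * I)) :
    -- real translations
    (d₂ ≠ 0 →
      ((∃ p : ℝ, MinLag.IsCylinderRel f p) ↔ ∃ q : ℚ, d₁ / d₂ = q)) ∧
    -- purely imaginary translations, `lam0⁻³ ψ` not real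
    (((lam0 : ℂ) ^ (-3 : ℤ) * ψ 0).im ≠ 0 →
      IntervalIntegrable (MinLag.betaOneIntegrand v (ψ 0) lam0) volume 0 (2 * T) ∧
      IntervalIntegrable (MinLag.betaTwoIntegrand v (ψ 0) lam0) volume 0 (2 * T) ∧
      ((∃ m : ℤ, MinLag.IsCylinderRel f (m * (2 * T) * I)) ↔
        MinLag.ImagPeriodCondition β (MinLag.betaOne v (ψ 0) lam0 (2 * T))
            (MinLag.betaTwo v (ψ 0) lam0 (2 * T)) d₁ ∧
        MinLag.ImagPeriodCondition β (MinLag.betaOne v (ψ 0) lam0 (2 * T))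
            (MinLag.betaTwo v (ψ 0) lam0 (2 * T)) d₂)) ∧
    -- purely imaginary translations, `lam0⁻³ ψ` real: the integrals are principal values
    (((lam0 : ℂ) ^ (-3 : ℤ) * ψ 0).im = 0 →
      ∃ B₁ B₂ : ℂ,
        MinLag.HasPrincipalValue (MinLag.betaOneIntegrand v (ψ 0) lam0)
          (MinLag.betaDen v (ψ 0) lam0) (2 * T) B₁ ∧
        MinLag.HasPrincipalValue (MinLag.betaTwoIntegrand v (ψ 0) lam0)
          (MinLag.betaDen v (ψ 0) lam0) (2 * T) B₂ ∧
        ((∃ m : ℤ, MinLag.IsCylinderRel f (m * (2 * T) * I)) ↔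
          MinLag.ImagPeriodCondition β B₁ B₂ d₁ ∧ MinLag.ImagPeriodCondition β B₁ B₂ d₂)) := by
  obtain ⟨F, h, hl⟩ := hf.exists_minimalLift
  set e : ℂ → ℝ := fun z => Real.exp (u z) with he
  have hS : ∀ t : ℝ, ∃ S, IsTranslator F t S := h.exists_translator hl hequiv
  have hl0 : (lam0 : ℂ) ^ (-3 : ℤ) ≠ 0 := zpow_ne_zero _ (Circle.coe_ne_zero lam0)
  set p : ℂ := (lam0 : ℂ) ^ (-3 : ℤ) * ψ 0 with hp
  have hΨ : ∀ z, -I * ((lam0 : ℂ) ^ (-3 : ℤ) * ψ z) = -I * p := h.hopf_const hS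
  have hψ0 : ψ 0 ≠ 0 := by
    obtain ⟨z, hz⟩ := hψ
    have h1 := mul_left_cancel₀ hl0 (mul_left_cancel₀ (neg_ne_zero.2 I_ne_zero) (hΨ z))
    rwa [← h1]
  have hnorm : ‖p‖ = ‖ψ 0‖ := norm_zpow_neg_three_mul lam0 (ψ 0)
  -- Regularity of u is not assumed; it follows from that of the lift through u = log e.
  have hu : Differentiable ℝ u := by
    have : u = fun z => Real.log (e z) := by funext z; simp [he]
    rw [this]
    exact (h.contDiff_metric.differentiable (by simp)).log fun z => (h.pos z).ne'
  have hfe : ∀ z, fderiv ℝ e z I = Real.exp (u z) * fderiv ℝ u z I := fun z => by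
    rw [he, ((hu z).hasFDerivAt.exp).fderiv]; simp
  have h0 : fderiv ℝ e 0 I = 0 := by rw [hfe, hu0, mul_zero]
  have hvd : ∀ s, Real.exp (v s) * deriv v s = fderiv ℝ e (s * I) I := fun s => by
    rw [hfe, hv, (hasDerivAt_imag hu s).deriv]
  have hve : ∀ s, Real.exp (v s) = e (s * I) := fun s => by rw [hv]
  have hTpos : 0 < T := hT ▸ halfPeriod_pos (Real.exp_pos _) hψ0 ha
  have hw : IsMetricProfile β (2 * T) (fun y => e (y * I)) (fun y => fderiv ℝ e (y * I) I) := by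
    rw [hβ, hT]
    refine h.isMetricProfile hS hψ0 ?_ h0 ha
    rw [norm_mul, norm_neg, Complex.norm_I, one_mul, hnorm]
  obtain ⟨h1, h2, h3⟩ := eigenvalue_relations (Real.exp_pos _) lam0 hd
  have hcube := betaConst_cube_gt (Real.exp_pos _) hψ0 ha
  have hQ : p.re ^ 2 ≤ ‖ψ 0‖ ^ 2 := by
    rw [← hnorm, ← sq_abs]
    exact pow_le_pow_left₀ (abs_nonneg _) (Complex.abs_re_le_norm p) 2
  obtain ⟨d, rfl, rfl, rfl⟩ : ∃ d : Fin 3 → ℝ, d 0 = d₁ ∧ d 1 = d₂ ∧ d 2 = d₃ :=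
    ⟨![d₁, d₂, d₃], rfl, rfl, rfl⟩
  have n01 : d 0 ≠ d 1 := ne_of_discriminant h1 h2 h3 hQ hcube
  have n02 : d 0 ≠ d 2 := ne_of_discriminant (d₃ := d 1) (by linarith) (by linarith) (by linarith)
    hQ hcube
  have n12 : d 1 ≠ d 2 := ne_of_discriminant (d₃ := d 0) (by linarith) (by linarith) (by linarith)
    hQ hcube
  have hinj : Function.Injective d := by
    intro j k hjk
    fin_cases j <;> fin_cases k <;> simp_all
  obtain ⟨L, hL⟩ := h.exists_modeBasis hS h0 hnorm rfl hinj h1 h2 h3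
  have hc1 := hw.continuous
  have hc2 := hw.continuous_deriv
  refine ⟨hL.exists_real_cylinder_iff h hl h1, fun hS0 => ?_, fun hS0 => ?_⟩
  · have hb1 : betaOneIntegrand v (ψ 0) lam0 = fun s : ℝ => (2 * I * (p.re - I * p.im) -
        I * (fderiv ℝ e (s * I) I : ℝ)) / (-2 * I * p.im - (fderiv ℝ e (s * I) I : ℝ)) :=
      funext fun s => betaOneIntegrand_eq hvd lam0 (ψ 0) s
    have hb2 : betaTwoIntegrand v (ψ 0) lam0 = fun s : ℝ => ((2 * e (s * I) : ℝ) : ℂ) /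
        (-2 * I * p.im - (fderiv ℝ e (s * I) I : ℝ)) :=
      funext fun s => betaTwoIntegrand_eq hve hvd lam0 (ψ 0) s
    refine ⟨?_, ?_, ?_⟩
    · rw [hb1]
      exact (Continuous.div (by fun_prop) (by fun_prop)
        fun s => phase_denominator_ne_zero hS0 _).intervalIntegrable _ _
    · rw [hb2]
      exact (Continuous.div (Complex.continuous_ofReal.comp (continuous_const.mul hc1))
        (by fun_prop)
        fun s => phase_denominator_ne_zero hS0 _).intervalIntegrable _ _
    · have hre := re_integral_betaOne hc2 hS0 p.re (2 * T)
      have him := im_integral_betaTwo hc1 hc2 hS0 (2 * T)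
      rw [hL.exists_imag_cylinder_iff h hl hTpos.ne' (fun j => Complex.exp_ne_zero _)
        (hL.multiplier_nonreal h hS hΨ hS0 hw)]
      unfold ImagPeriodCondition betaOne betaTwo
      rw [hb1, hb2, hre, him]
      set A := ∫ s in (0 : ℝ)..(2 * T), (1 / (-2 * I * p.im - (fderiv ℝ e (s * I) I : ℝ)) : ℂ).im
      set B := ∫ s in (0 : ℝ)..(2 * T), e (s * I) *
        (1 / (-2 * I * p.im - (fderiv ℝ e (s * I) I : ℝ)) : ℂ).im
      -- θ_j is the left side of the period condition. The shift 2β/3 makes the θ_j sum to 0,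
      -- because the squares of the d_j sum to 2β, and θ_j + τ_j does not involve d_j.
      refine exists_common_multiplier_iff
        (θ := fun j => -2 * p.re * A * d j + 2 * B * (-d j ^ 2 + 2 * β / 3)) ?_ fun j k => ?_
      · have h4 : d 0 ^ 2 + d 1 ^ 2 + d 2 ^ 2 = 2 * β := by
          rw [hβ]
          linear_combination (d 0 + d 1 + d 2) * h1 - 2 * h2
        linear_combination (-2 * p.re * A) * h1 - 2 * B * h4
      · rw [im_integral_modeCoeff hc1 hc2 hS0, im_integral_modeCoeff hc1 hc2 hS0]
        ring
  · have hden : betaDen v (ψ 0) lam0 = fun s : ℝ => ((-fderiv ℝ e (s * I) I : ℝ) : ℂ) := by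
      funext s
      rw [betaDen_eq hvd, ← hp, hS0]
      simp
    have hcont : Continuous (betaDen v (ψ 0) lam0) := by rw [hden]; fun_prop
    have hzero : betaDen v (ψ 0) lam0 0 = 0 := by
      rw [hden]
      simp only [ofReal_zero, zero_mul, h0]
      simp
    have hodd : ∀ s, betaDen v (ψ 0) lam0 (2 * T - s) = -betaDen v (ψ 0) lam0 s := fun s => by
      rw [hden]
      have := hw.reflect_deriv s
      simp only at this ⊢
      rw [this]
      simp
    -- With Im p = 0 the integrand of β₁ is i + 2i Re p / `den`: a constant plus a function odd
    -- under s ↦ 2T − s.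
    obtain ⟨V, hV⟩ := exists_hasPrincipalValue_const_add_odd (k := betaOneIntegrand v (ψ 0) lam0)
      (P := 2 * T) I (2 * I * p.re) hcont hzero hodd fun s hs => by
        rw [eq_comm, add_comm, ← eq_sub_iff_add_eq]
        have h5 := betaOneIntegrand_eq hvd lam0 (ψ 0) s
        have h6 := betaDen_eq hvd lam0 (ψ 0) s
        rw [← h6] at h5
        rw [h5, ← hp, div_eq_iff hs, sub_mul, div_mul_cancel₀ _ hs, h6, ← hp, hS0]
        push_cast
        ring
    refine ⟨V * I, 0, hV, hasPrincipalValue_zero_of_odd hcont hzero hodd fun s => ?_, ?_⟩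
    · have h5 : ∀ s, betaTwoIntegrand v (ψ 0) lam0 s =
          ((2 * e (s * I) : ℝ) : ℂ) / betaDen v (ψ 0) lam0 s := fun s => by
        rw [betaTwoIntegrand_eq hve hvd, betaDen_eq hvd]
      have h6 : e ((2 * T - s : ℝ) * I) = e (s * I) := hw.reflect s
      rw [h5, h5, hodd, h6, div_neg]
    · have htriv : ∀ d : ℝ, ImagPeriodCondition β (V * I) 0 d := fun d => ⟨0, by simp⟩
      refine iff_of_true ?_ ⟨htriv _, htriv _⟩
      choose μ hμ hM using hL.multiplier_real h hS hΨ hS0 hw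
      rw [hL.exists_imag_cylinder_iff h hl hTpos.ne' (M := μ) (fun j hj => by
        have := hμ j
        rw [hj] at this
        norm_num at this) hM]
      -- The multipliers are ±1, so two periods always suffice.
      exact ⟨2, two_ne_zero, fun j k => by
        have h7 : ∀ j, μ j ^ (2 : ℤ) = 1 := fun j => by exact_mod_cast hμ j
        rw [h7, h7]⟩
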